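/- All von Neumann algebras act on complex Hilbert spaces. An NCP-map is a linear map between von Neumann algebras that is completely positive and normal (it preserves suprema of bounded directed sets); an NMIU-map is a normal unital $*$-homomorphism. An NCP-map $\varphi\colon\mathscr{A}\to\mathscr{B}$ is NCP-extreme if it is an extreme point of the convex set of NCP-maps $\psi\colon\mathscr{A}\to\mathscr{B}$ with $\psi(1)=\varphi(1)$; that is, if $\varphi=\lambda\varphi_1+(1-\lambda)\varphi_2$ with $0<\lambda<1$ and NCP-maps $\varphi_1,\varphi_2\colon\mathscr{A}\to\mathscr{B}$ satisfying $\varphi_1(1)=\varphi_2(1)=\varphi(1)$, then $\varphi_1=\varphi_2=\varphi$. A contractive NCP-map $\varphi\colon\mathscr{A}\to\mathscr{B}$ has a carrier $p$, the least projection of $\mathscr{A}$ with $\varphi(p)=\varphi(1)$; let $q$ be the support projection of $\varphi(1)$, the least projection of $\mathscr{B}$ with $\varphi(1)\le q$. There is a unique NCP-map $\psi\colon p\mathscr{A}p\to q\mathscr{B}q$ with $\varphi(a)=\sqrt{\varphi(1)}\,\psi(pap)\,\sqrt{\varphi(1)}$ for all $a\in\mathscr{A}$, and $\varphi$ is called pure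 if $\psi$ is an isomorphism (it has an inverse that is an NCP-map). A general NCP-map $\varphi\neq 0$ is pure if $\|\varphi\|^{-1}\varphi$ is pure, and the zero map is pure. A Paschke dilation of an NCP-map $\varphi\colon\mathscr{A}\to\mathscr{B}$ is a von Neumann algebra $\mathscr{P}$ with an NMIU-map $\varrho\colon\mathscr{A}\to\mathscr{P}$ and an NCP-map $f\colon\mathscr{P}\to\mathscr{B}$ such that $\varphi=f\circ\varrho$ and such that for every von Neumann algebra $\mathscr{P}'$, NMIU-map $\varrho'\colon\mathscr{A}\to\mathscr{P}'$ and NCP-map $f'\colon\mathscr{P}'\to\mathscr{B}$ with $\varphi=f'\circ\varrho'$ there is a unique NCP-map $\sigma\colon\mathscr{P}'\to\mathscr{P}$ with $\sigma\circ\varrho'=\varrho$ and $f\circ\sigma=f'$. Theorem. Let $\mathscr{A}$ and $\mathscr{B}$ be von Neumann algebras. (1) Every NMIU-map $\mathscr{A}\to\mathscr{B}$ is NCP-extreme. (2) Every pure NCP-map $\mathscr{A}\to\mathscr{B}$ is NCP-extreme. (3) If $(\mathscr{P},\varrho,f)$ is a Paschke dilation of an NCP-map $\varphi\colon\mathscr{A}\to\mathscr{B}$,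 then both $\varrho$ and $f$ are NCP-extreme. -/

import Mathlib

universe u

namespace VonNeumannAlgebra

section Operators

variable {H : Type u} [NormedAddCommGroup H] [InnerProductSpace ℂ H]

/-- The compression of an operator on `H` to the closed subspace `U`. -/
noncomputable def compressOp (U : Submodule ℂ H) [U.HasOrthogonalProjection] (T : H →L[ℂ] H) :
    U →L[ℂ] U :=
  U.orthogonalProjectionOnto ∘L T ∘L U.subtypeL

/-- The extension by `0` of an operator on the closed subspace `U` to `H`. -/
noncomputable def extendOp (U : Submodule ℂ H) [U.HasOrthogonalProjection] (T : U →L[ℂ] U) :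
    H →L[ℂ] H :=
  U.subtypeL ∘L T ∘L U.orthogonalProjectionOnto

variable (U : Submodule ℂ H) [U.HasOrthogonalProjection]

theorem extendOp_compressOp (T : H →L[ℂ] H) :
    extendOp U (compressOp U T) = U.starProjection * T * U.starProjection := rfl

theorem compressOp_extendOp (T : U →L[ℂ] U) : compressOp U (extendOp U T) = T := by
  ext x
  simp [compressOp, extendOp]

theorem extendOp_mul (S T : U →L[ℂ] U) : extendOp U (S * T) = extendOp U S * extendOp U T := by
  ext x
  simp [extendOp]

theorem extendOp_one : extendOp U 1 = U.starProjection := rfl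

theorem extendOp_add (S T : U →L[ℂ] U) : extendOp U (S + T) = extendOp U S + extendOp U T := by
  ext x
  simp [extendOp]

theorem extendOp_smul (c : ℂ) (T : U →L[ℂ] U) : extendOp U (c • T) = c • extendOp U T := by
  ext x
  simp [extendOp]

theorem extendOp_star [CompleteSpace H] [CompleteSpace U] (T : U →L[ℂ] U) :
    extendOp U (star T) = star (extendOp U T) := by
  rw [ContinuousLinearMap.star_eq_adjoint, ContinuousLinearMap.star_eq_adjoint,
    ContinuousLinearMap.eq_adjoint_iff]
  intro x y
  have h1 : ∀ (u : U) (z : H), inner ℂ (u : H) z = inner ℂ u (U.orthogonalProjectionOnto z) :=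
    fun u z => (U.inner_orthogonalProjectionOnto_eq_of_mem_left u z).symm
  have h2 : ∀ (u : U) (z : H), inner ℂ z (u : H) = inner ℂ (U.orthogonalProjectionOnto z) u :=
    fun u z => (U.inner_orthogonalProjectionOnto_eq_of_mem_right u z).symm
  change inner ℂ ((ContinuousLinearMap.adjoint T (U.orthogonalProjectionOnto x) : U) : H) y
    = inner ℂ x ((T (U.orthogonalProjectionOnto y) : U) : H)
  rw [h1, h2, ContinuousLinearMap.adjoint_inner_left]

end Operators

section Structure

variable {H : Type u} [NormedAddCommGroup H] [InnerProductSpace ℂ H] [CompleteSpace H]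

/-! A (concrete) von Neumann algebra, with its elements regarded as a C⋆-algebra with the order
inherited from the Loewner order of `H →L[ℂ] H`. -/

instance instSMulMemClass : SMulMemClass (VonNeumannAlgebra H) ℂ (H →L[ℂ] H) where
  smul_mem {A} r _ ha := A.toStarSubalgebra.smul_mem ha r

instance instIsClosed (A : VonNeumannAlgebra H) : IsClosed (A : Set (H →L[ℂ] H)) := by
  rw [← A.centralizer_centralizer]
  exact Set.isClosed_centralizer _

theorem sqrt_mem (A : VonNeumannAlgebra H) {x : H →L[ℂ] H} (hx : x ∈ A) : CFC.sqrt x ∈ A := by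
  rw [← A.commutant_commutant, mem_commutant_iff]
  intro g hg
  have hc : Commute x g := mem_commutant_iff.1 hg x hx
  exact (hc.cfcₙ_nnreal NNReal.sqrt).eq.symm

instance instStarOrderedRing (A : VonNeumannAlgebra H) : StarOrderedRing A := by
  refine StarOrderedRing.of_nonneg_iff' ?_ ?_
  · intro x y hxy z
    exact add_le_add_right (α := H →L[ℂ] H) hxy z
  · intro x
    constructor
    · intro hx
      have hx' : (0 : H →L[ℂ] H) ≤ (x : H →L[ℂ] H) := hx
      refine ⟨⟨CFC.sqrt (x : H →L[ℂ] H), A.sqrt_mem x.2⟩, Subtype.ext ?_⟩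
      change (x : H →L[ℂ] H) = star (CFC.sqrt (x : H →L[ℂ] H)) * CFC.sqrt (x : H →L[ℂ] H)
      rw [(IsSelfAdjoint.of_nonneg (CFC.sqrt_nonneg (x : H →L[ℂ] H))).star_eq,
        CFC.sqrt_mul_sqrt_self _ hx']
    · rintro ⟨s, rfl⟩
      exact star_mul_self_nonneg (s : H →L[ℂ] H)

/-- The projections of the von Neumann algebra `A`. -/
structure Proj (A : VonNeumannAlgebra H) : Type u where
  /-- the projection as an element of `A` -/
  val : A
  isStarProjection : IsStarProjection val

variable {A : VonNeumannAlgebra H}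

/-- The underlying operator of a projection. -/
def Proj.op (p : A.Proj) : H →L[ℂ] H := (p.val : A)

theorem Proj.op_mem (p : A.Proj) : p.op ∈ A := p.val.2

theorem Proj.isStarProjection_op (p : A.Proj) : IsStarProjection p.op :=
  ⟨congrArg Subtype.val p.isStarProjection.isIdempotentElem.eq, congrArg Subtype.val p.isStarProjection.isSelfAdjoint.star_eq⟩

/-- The closed subspace `pH` of `H`. -/
def Proj.space (p : A.Proj) : Submodule ℂ H := p.op.range

instance Proj.instHasOrthogonalProjection (p : A.Proj) : p.space.HasOrthogonalProjection :=
  (isStarProjection_iff_eq_starProjection_range.1 p.isStarProjection_op).1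

instance Proj.instCompleteSpace (p : A.Proj) : CompleteSpace p.space := by
  have h : IsClosed (p.space : Set H) := by
    rw [← p.space.orthogonal_orthogonal]
    exact Submodule.isClosed_orthogonal _
  exact h.completeSpace_coe

theorem Proj.starProjection_space (p : A.Proj) : p.space.starProjection = p.op :=
  (isStarProjection_iff_eq_starProjection_range.1 p.isStarProjection_op).2.symm

/-- The von Neumann algebra `pAp`, acting on the Hilbert space `pH`: its elements are the operators
on `pH` whose extension by `0` to `H` belongs to `A`. -/
noncomputable def corner (A : VonNeumannAlgebra H) (p : A.Proj) : VonNeumannAlgebra p.space where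
  carrier := {T | extendOp p.space T ∈ A}
  mul_mem' {S T} hS hT := by
    simp only [Set.mem_ofPred_eq] at *
    rw [extendOp_mul]; exact mul_mem hS hT
  one_mem' := by
    simp only [Set.mem_ofPred_eq]
    rw [extendOp_one, p.starProjection_space]; exact p.op_mem
  add_mem' {S T} hS hT := by
    simp only [Set.mem_ofPred_eq] at *
    rw [extendOp_add]; exact add_mem hS hT
  zero_mem' := by
    have h : extendOp p.space (0 : p.space →L[ℂ] p.space) = 0 := by ext x; simp [extendOp]
    simp only [Set.mem_ofPred_eq]
    rw [h]; exact zero_mem A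
  algebraMap_mem' c := by
    simp only [Set.mem_ofPred_eq]
    rw [Algebra.algebraMap_eq_smul_one, extendOp_smul, extendOp_one, p.starProjection_space]
    exact SMulMemClass.smul_mem c p.op_mem
  star_mem' {T} hT := by
    simp only [Set.mem_ofPred_eq] at *
    rw [extendOp_star]; exact star_mem hT
  centralizer_centralizer' := by
    refine Set.Subset.antisymm ?_ Set.subset_centralizer_centralizer
    intro T hT
    change extendOp p.space T ∈ A
    suffices h : extendOp p.space T ∈ A.commutant.commutant by
      rwa [A.commutant_commutant] at h
    rw [mem_commutant_iff]
    intro g hg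
    have hgA : ∀ a ∈ A, a * g = g * a := fun a ha => mem_commutant_iff.1 hg a ha
    have hgp : p.space.starProjection * g = g * p.space.starProjection := by
      rw [p.starProjection_space]; exact hgA _ p.op_mem
    have hp : p.space.starProjection * p.space.starProjection = p.space.starProjection := by
      rw [p.starProjection_space]; exact p.isStarProjection_op.isIdempotentElem.eq
    have hl : ∀ S : p.space →L[ℂ] p.space,
        p.space.starProjection * extendOp p.space S = extendOp p.space S := fun S => by
      rw [← extendOp_one, ← extendOp_mul, one_mul]
    have hr : ∀ S : p.space →L[ℂ] p.space,
        extendOp p.space S * p.space.starProjection = extendOp p.space S := fun S => by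
      rw [← extendOp_one, ← extendOp_mul, mul_one]
    have hc : extendOp p.space (compressOp p.space g) = g * p.space.starProjection := by
      rw [extendOp_compressOp, hgp, mul_assoc, hp]
    have hc' : extendOp p.space (compressOp p.space g) = p.space.starProjection * g := by
      rw [hc, hgp]
    have hmem : compressOp p.space g ∈
        Set.centralizer {S : p.space →L[ℂ] p.space | extendOp p.space S ∈ A} := by
      intro S hS
      have h := hgA _ hS
      have h2 : extendOp p.space (S * compressOp p.space g)
          = extendOp p.space (compressOp p.space g * S) := by
        rw [extendOp_mul, extendOp_mul, hc, mul_assoc, hl, ← hgp, ← mul_assoc, hr, h]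
      have h3 := congrArg (compressOp p.space) h2
      rwa [compressOp_extendOp, compressOp_extendOp] at h3
    have hTg : compressOp p.space g * T = T * compressOp p.space g := hT _ hmem
    have h4 := congrArg (extendOp p.space) hTg
    rw [extendOp_mul, extendOp_mul, hc, mul_assoc, hl, ← hgp, ← mul_assoc, hr] at h4
    exact h4

/-- The standard corner `A → pAp`, `a ↦ pap`, of a projection `p`. -/
noncomputable def standardCorner (A : VonNeumannAlgebra H) (p : A.Proj) :
    A →ₗ[ℂ] A.corner p where
  toFun a := ⟨compressOp p.space (a : H →L[ℂ] H), by
    change extendOp p.space _ ∈ A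
    rw [extendOp_compressOp, p.starProjection_space]
    exact mul_mem (mul_mem p.op_mem a.2) p.op_mem⟩
  map_add' a b := by
    apply Subtype.ext
    ext x
    simp [compressOp]
  map_smul' c a := by
    apply Subtype.ext
    ext x
    simp [compressOp]

/-- The map `qAq → A`, `b ↦ √a b √a`. When `q` is the support projection of the effect `a`, this
is the standard compression of `a`. -/
noncomputable def standardCompression (A : VonNeumannAlgebra H) (a : A) (q : A.Proj) :
    A.corner q →ₗ[ℂ] A where
  toFun b := ⟨CFC.sqrt (a : H →L[ℂ] H) * extendOp q.space b * CFC.sqrt (a : H →L[ℂ] H),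
    mul_mem (mul_mem (A.sqrt_mem a.2) b.2) (A.sqrt_mem a.2)⟩
  map_add' b c := by
    apply Subtype.ext
    change _ * extendOp q.space (b + c : q.space →L[ℂ] q.space) * _ = _ * _ * _ + _ * _ * _
    rw [extendOp_add, mul_add, add_mul]
  map_smul' r b := by
    apply Subtype.ext
    change _ * extendOp q.space (r • b : q.space →L[ℂ] q.space) * _ = r • (_ * _ * _)
    rw [extendOp_smul, mul_smul_comm, smul_mul_assoc]

/-- `q` is the support projection of the effect `a`: the least projection above `a`. -/
def IsSupportProj (a : A) (q : A.Proj) : Prop :=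
  IsLeast {e : A | IsStarProjection e ∧ a ≤ e} q.val

end Structure

section Maps

variable {H K : Type u} [NormedAddCommGroup H] [InnerProductSpace ℂ H] [CompleteSpace H]
  [NormedAddCommGroup K] [InnerProductSpace ℂ K] [CompleteSpace K]
  {A : VonNeumannAlgebra H} {B : VonNeumannAlgebra K}

/-- `φ` is an NCP-map: it is completely positive and normal, i.e. it preserves suprema of
(bounded) directed sets. -/
structure IsNCP (φ : A →ₗ[ℂ] B) : Prop where
  completelyPositive : ∃ f : CompletelyPositiveMap A B, f.toLinearMap = φ
  normal : ScottContinuous φ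

/-- `ϱ` is an NMIU-map: a unital ⋆-homomorphism (as recorded in its type) which is normal. -/
def IsNMIU (ϱ : A →⋆ₐ[ℂ] B) : Prop := ScottContinuous ϱ

/-- A unital ⋆-homomorphism as a linear map. -/
noncomputable def linearMapOfHom (ϱ : A →⋆ₐ[ℂ] B) : A →ₗ[ℂ] B := ϱ.toAlgHom.toLinearMap

/-- `φ` is an isomorphism in the category of von Neumann algebras and NCP-maps. -/
def IsNCPIso (φ : A →ₗ[ℂ] B) : Prop :=
  IsNCP φ ∧ ∃ ψ : B →ₗ[ℂ] A, IsNCP ψ ∧ ψ ∘ₗ φ = LinearMap.id ∧ φ ∘ₗ ψ = LinearMap.id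

/-- `φ` is NCP-extreme: it is an extreme point of the set of NCP-maps that have the same value
on `1` as `φ`. -/
def IsNCPExtreme (φ : A →ₗ[ℂ] B) : Prop :=
  φ ∈ Set.extremePoints ℝ {ψ : A →ₗ[ℂ] B | IsNCP ψ ∧ ψ 1 = φ 1}

/-- `p` is the carrier of `φ`: the least projection `e` with `φ e = φ 1`. -/
def IsCarrier (φ : A →ₗ[ℂ] B) (p : A.Proj) : Prop :=
  IsLeast {e : A | IsStarProjection e ∧ φ e = φ 1} p.val

/-- A contractive NCP-map `φ` is pure if in its (unique) factorization `φ = c ∘ ψ ∘ h`, where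
`h : A → pAp` is the standard corner of its carrier `p`, where `c : qBq → B` is the standard
compression of `φ 1` with support projection `q`, and where `ψ : pAp → qBq` is an NCP-map,
the map `ψ` is an isomorphism. -/
def IsPureContractive (φ : A →ₗ[ℂ] B) : Prop :=
  ∃ (p : A.Proj) (q : B.Proj), IsCarrier φ p ∧ IsSupportProj (φ 1) q ∧
    ∃ ψ : A.corner p →ₗ[ℂ] B.corner q, IsNCPIso ψ ∧
      B.standardCompression (φ 1) q ∘ₗ ψ ∘ₗ A.standardCorner p = φ

/-- An NCP-map `φ` is pure if the contractive map `‖φ‖⁻¹ φ` is. Here `‖φ‖ = ‖φ 1‖`, because `φ` is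
positive; the zero map is pure. For contractive `φ` this amounts to `IsPureContractive φ`, because
rescaling `φ` changes neither `p`, nor `q`, nor `ψ`. -/
def IsPure (φ : A →ₗ[ℂ] B) : Prop :=
  IsPureContractive (((‖φ 1‖⁻¹ : ℝ) : ℂ) • φ)

/-- `A --ϱ--> P --f--> B` is a Paschke dilation of `φ : A → B`. -/
structure IsPaschkeDilation {L : Type u} [NormedAddCommGroup L] [InnerProductSpace ℂ L]
    [CompleteSpace L] {P : VonNeumannAlgebra L}
    (φ : A →ₗ[ℂ] B) (ϱ : A →⋆ₐ[ℂ] P) (f : P →ₗ[ℂ] B) : Prop where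
  nmiu : IsNMIU ϱ
  ncp : IsNCP f
  comp_eq : f ∘ₗ linearMapOfHom ϱ = φ
  existsUnique : ∀ (L' : Type u) [NormedAddCommGroup L'] [InnerProductSpace ℂ L']
    [CompleteSpace L'] (P' : VonNeumannAlgebra L') (ϱ' : A →⋆ₐ[ℂ] P') (f' : P' →ₗ[ℂ] B),
    IsNMIU ϱ' → IsNCP f' → f' ∘ₗ linearMapOfHom ϱ' = φ →
      ∃! σ : P' →ₗ[ℂ] P, IsNCP σ ∧ σ ∘ₗ linearMapOfHom ϱ' = linearMapOfHom ϱ ∧ f ∘ₗ σ = f'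

end Maps

end VonNeumannAlgebra

namespace VonNeumannAlgebra

open Filter Topology ComplexOrder ContinuousLinearMap

/-! ### Bounded directed sets converge strongly to their suprema. -/

section Vigier

variable {H : Type u} [NormedAddCommGroup H] [InnerProductSpace ℂ H]

/-! All three parts rest on one variational argument, `eq_of_convex_combination`. Suppose `φ = s φ₁
+ t φ₂` with equal values at `1`, and let `φ 1 = V⋆V`, `φ a = V⋆SV`, `φ (a⋆a) = V⋆S⋆SV`, with `S V
x` in the closure of the range of `V`. Positivity of each `φᵢ` on the pair `1, a` gives `0 ≤ ‖V zᵢ‖²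
+ 2 Re ⟪zᵢ, φᵢ(a) x⟫ + ⟪x, φᵢ(a⋆a) x⟫`. Take `z₁ = z + t w`, `z₂ = z - s w` and average: with `y =
φ₁(a) x - φ₂(a) x`, this becomes `0 ≤ ‖V z + S V x‖² + s t (‖V w‖² + 2 Re ⟪w, y⟫)`. The first term
can be made arbitrarily small by choice of `z`, so the bracket is nonnegative for all `w`; rescaling
`w` forces `y = 0`. Normality of `φ₁`, `φ₂` plays no role, hence the notion `IsCPExtreme`.

For a ⋆-homomorphism, `V = 1`. For a pure map, `V = √(φ 1)` and `S` is `ψ(pap)` extended by zero: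
`ψ` preserves `a⋆a` because Kadison–Schwarz applies to it and to its inverse, and the support
projection is dominated by the range projection of `√(φ 1)`.

For a Paschke dilation, `ϱ` is again a ⋆-homomorphism. For `f`, a minimal Stinespring-type dilation
of `f` itself is built: a normal representation `rep` of `P` followed by a compression `compress =
V⋆ · V`, to which the variational argument applies after cutting down by the range projection of
`V`. The universal property gives `σ` with `f ∘ σ = compress`, and its uniqueness clause gives `σ ∘
rep = id`. A decomposition of `f` thus pulls back along `σ` to one of `compress`, which is trivial,
and composing with `rep` returns to `f`. -/

theorem nonneg_iff_inner {T : H →L[ℂ] H} : 0 ≤ T ↔ ∀ x, 0 ≤ inner ℂ x (T x) := by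
  rw [nonneg_iff_isPositive]
  refine ⟨fun h x => h.inner_nonneg_right x, fun h => (isPositive_iff_complex T).2 fun x => ?_⟩
  have h1 := h x
  rw [← inner_conj_symm, RCLike.nonneg_iff] at h1
  simp only [RCLike.conj_re, RCLike.conj_im] at h1
  refine ⟨?_, h1.1⟩
  apply Complex.ext
  · simp
  · have := h1.2
    simp only [RCLike.im_to_complex, neg_eq_zero] at this
    simp [this]

/-- Factoring `T = s⋆s` gives `‖T x‖ ≤ ‖s‖ ‖s x‖`. This upgrades weak convergence of monotone nets
to strong convergence. -/
theorem norm_sq_apply_le_of_nonneg [CompleteSpace H] {T : H →L[ℂ] H} (hT : 0 ≤ T) (x : H) :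
    ‖T x‖ ^ 2 ≤ ‖T‖ * (inner ℂ x (T x)).re := by
  obtain ⟨s, hs⟩ := CStarAlgebra.nonneg_iff_eq_star_mul_self.1 hT
  have h1 : (inner ℂ x (T x)).re = ‖s x‖ ^ 2 := by
    rw [hs, star_eq_adjoint]
    change (inner ℂ x (adjoint s (s x))).re = _
    rw [adjoint_inner_right, inner_self_eq_norm_sq_to_K]
    norm_cast
  have h2 : ‖T‖ = ‖s‖ ^ 2 := by rw [hs, CStarRing.norm_star_mul_self, sq]
  have h3 : ‖T x‖ ≤ ‖s‖ * ‖s x‖ := by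
    rw [hs, star_eq_adjoint]
    change ‖adjoint s (s x)‖ ≤ _
    simpa using (adjoint s).le_opNorm (s x)
  rw [h1, h2, ← mul_pow]
  exact pow_le_pow_left₀ (norm_nonneg _) h3 2

variable [CompleteSpace H] {A : VonNeumannAlgebra H}

theorem inner_sub_nonneg {a b : A} (h : a ≤ b) (x : H) :
    0 ≤ inner ℂ x (((b - a : A) : H →L[ℂ] H) x) :=
  nonneg_iff_inner.1 (sub_nonneg.2 (show (a : H →L[ℂ] H) ≤ b from h)) x

theorem le_of_inner_sub_nonneg {a b : A}
    (h : ∀ x, 0 ≤ inner ℂ x (((b - a : A) : H →L[ℂ] H) x)) : a ≤ b :=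
  sub_nonneg.1 (nonneg_iff_inner.2 h)

theorem inner_sub_le_inner_sub {a b c : A} (h : b ≤ c) (x : H) :
    (inner ℂ x (((a - c : A) : H →L[ℂ] H) x)).re
      ≤ (inner ℂ x (((a - b : A) : H →L[ℂ] H) x)).re := by
  have h1 := (Complex.le_def.1 (inner_sub_nonneg h x)).1
  have h2 : (a - b : A) = (a - c) + (c - b) := by abel
  rw [h2]
  change _ ≤ (inner ℂ x (((a - c : A) : H →L[ℂ] H) x + ((c - b : A) : H →L[ℂ] H) x)).re
  rw [inner_add_right, Complex.add_re]
  exact le_add_of_nonneg_right h1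

/-- A bounded directed set in a von Neumann algebra converges strongly to an upper bound that lies
in the algebra. -/
theorem exists_strong_limit {D : Set A} (hne : D.Nonempty) (hdir : DirectedOn (· ≤ ·) D)
    (hbdd : BddAbove D) :
    ∃ t : A, ∀ x, Tendsto (fun d : D => ((d : A) : H →L[ℂ] H) x) atTop
      (𝓝 ((t : H →L[ℂ] H) x)) := by
  obtain ⟨d0, hd0⟩ := hne
  obtain ⟨b, hb⟩ := hbdd
  have : Nonempty D := ⟨⟨d0, hd0⟩⟩
  have : IsDirectedOrder D := ⟨fun x y => by
    obtain ⟨z, hz, h1, h2⟩ := hdir x.1 x.2 y.1 y.2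
    exact ⟨⟨z, hz⟩, h1, h2⟩⟩
  set C := ‖((b - d0 : A) : H →L[ℂ] H)‖
  have hnorm : ∀ d e : D, d0 ≤ (d : A) → d ≤ e → ‖((e - d : A) : H →L[ℂ] H)‖ ≤ C := by
    intro d e hd hde
    refine CStarAlgebra.norm_le_norm_of_nonneg_of_le (sub_nonneg.2 hde) ?_
    exact sub_le_sub (hb e.2) hd
  have hcauchy : ∀ x, ∃ y, Tendsto (fun d : D => ((d : A) : H →L[ℂ] H) x) atTop (𝓝 y) := by
    intro x
    refine cauchy_map_iff_exists_tendsto.1 (Metric.cauchy_iff.2 ⟨inferInstance, fun ε hε => ?_⟩)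
    let g : D → ℝ := fun d => (inner ℂ x (((b - d : A) : H →L[ℂ] H) x)).re
    have hgb : BddBelow (Set.range g) := ⟨0, by
      rintro _ ⟨d, rfl⟩
      exact (Complex.le_def.1 (inner_sub_nonneg (hb d.2) x)).1⟩
    have hδ : 0 < (ε / 2) ^ 2 / (C + 1) := by positivity
    -- `N` nearly minimizes the antitone `g`, so `g` hardly varies beyond it. Passing above `d0` as
    -- well makes `C` bound the norms of the differences; `C + 1` avoids dividing by zero.
    obtain ⟨_, ⟨N, rfl⟩, hN⟩ := exists_lt_of_csInf_lt (Set.range_nonempty g)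
      (lt_add_of_pos_right (sInf (Set.range g)) hδ)
    obtain ⟨M, hM1, hM2⟩ := exists_ge_ge N (⟨d0, hd0⟩ : D)
    have key : ∀ d : D, M ≤ d →
        dist (((d : A) : H →L[ℂ] H) x) (((M : A) : H →L[ℂ] H) x) < ε / 2 := by
      intro d hd
      have h1 := norm_sq_apply_le_of_nonneg
        (show (0 : H →L[ℂ] H) ≤ ((d - M : A) : H →L[ℂ] H) from sub_nonneg.2 hd) x
      have h2 : (inner ℂ x (((d - M : A) : H →L[ℂ] H) x)).re = g M - g d := by
        have : (d - M : A) = (b - M) - (b - d) := by abel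
        simp only [g]
        rw [this]
        change (inner ℂ x (((b - M : A) : H →L[ℂ] H) x - ((b - d : A) : H →L[ℂ] H) x)).re = _
        rw [inner_sub_right, Complex.sub_re]
      have h3 : g M ≤ g N := inner_sub_le_inner_sub hM1 x
      have h4 : sInf (Set.range g) ≤ g d := csInf_le hgb ⟨d, rfl⟩
      have h5 : g M - g d < (ε / 2) ^ 2 / (C + 1) := by linarith
      have h6 : 0 ≤ g M - g d := by
        rw [← h2]; exact (Complex.le_def.1 (inner_sub_nonneg (a := (M : A)) (b := d) hd x)).1
      rw [dist_eq_norm]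
      change ‖((d - M : A) : H →L[ℂ] H) x‖ < ε / 2
      rw [h2] at h1
      have h7 : ‖((d - M : A) : H →L[ℂ] H) x‖ ^ 2 < (ε / 2) ^ 2 := by
        calc _ ≤ _ := h1
          _ ≤ (C + 1) * (g M - g d) := by
            apply mul_le_mul_of_nonneg_right _ h6
            linarith [hnorm M d hM2 hd]
          _ < (C + 1) * ((ε / 2) ^ 2 / (C + 1)) := by
            apply mul_lt_mul_of_pos_left h5; positivity
          _ = _ := mul_div_cancel₀ _ (by positivity)
      exact lt_of_pow_lt_pow_left₀ 2 (by positivity) h7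
    refine ⟨(fun d : D => ((d : A) : H →L[ℂ] H) x) '' Set.Ici M,
      image_mem_map (Ici_mem_atTop M), ?_⟩
    rintro _ ⟨d, hd, rfl⟩ _ ⟨e, he, rfl⟩
    calc _ ≤ _ := dist_triangle_right _ _ (((M : A) : H →L[ℂ] H) x)
      _ < ε / 2 + ε / 2 := add_lt_add (key d hd) (key e he)
      _ = ε := by ring
  choose t ht using hcauchy
  let T : H →ₗ[ℂ] H :=
    { toFun := t
      map_add' := fun x y => tendsto_nhds_unique (ht (x + y))
        (by simpa using (ht x).add (ht y))
      map_smul' := fun c x => tendsto_nhds_unique (ht (c • x))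
        (by simpa using (ht x).const_smul c) }
  have hT : ∀ x, ‖T x‖ ≤ (‖(d0 : H →L[ℂ] H)‖ + C) * ‖x‖ := by
    intro x
    refine le_of_tendsto (ht x).norm ?_
    filter_upwards [Ici_mem_atTop (⟨d0, hd0⟩ : D)] with d hd
    refine (((d : A) : H →L[ℂ] H).le_opNorm x).trans ?_
    gcongr
    have h1 : ((d : A) : H →L[ℂ] H) = (d0 : H →L[ℂ] H) + ((d - d0 : A) : H →L[ℂ] H) := by
      change _ = (d0 : H →L[ℂ] H) + (((d : A) : H →L[ℂ] H) - (d0 : H →L[ℂ] H))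
      abel
    rw [h1]
    exact (norm_add_le _ _).trans (add_le_add le_rfl (hnorm ⟨d0, hd0⟩ d le_rfl hd))
  let T' : H →L[ℂ] H := T.mkContinuous _ hT
  -- Commuting with a fixed bounded operator survives strong limits, so the double commutant theorem
  -- applies.
  have hmem : T' ∈ A := by
    rw [← A.commutant_commutant, mem_commutant_iff]
    intro g hg
    ext x
    refine tendsto_nhds_unique (((g.continuous.tendsto _).comp (ht x)).congr fun d => ?_) (ht (g x))
    have := mem_commutant_iff.1 hg d.1 d.1.2
    exact (congrArg (fun S : H →L[ℂ] H => S x) this).symm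
  exact ⟨⟨T', hmem⟩, ht⟩

/-- The strong limit `t` is an upper bound, so `a ≤ t` and `⟪x, (a - d) x⟫ ≤ ⟪x, (t - d) x⟫ → 0`.
Order suprema thereby become testable on vector states. -/
theorem exists_inner_sub_lt {D : Set A} (hne : D.Nonempty) (hdir : DirectedOn (· ≤ ·) D) {a : A}
    (ha : IsLUB D a) (x : H) {ε : ℝ} (hε : 0 < ε) :
    ∃ d ∈ D, (inner ℂ x (((a - d : A) : H →L[ℂ] H) x)).re < ε := by
  obtain ⟨t, ht⟩ := exists_strong_limit hne hdir ⟨a, ha.1⟩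
  have : Nonempty D := hne.to_subtype
  have : IsDirectedOrder D := ⟨fun x y => by
    obtain ⟨z, hz, h1, h2⟩ := hdir x.1 x.2 y.1 y.2
    exact ⟨⟨z, hz⟩, h1, h2⟩⟩
  have hlim : ∀ (c : A) (x : H), Tendsto
      (fun d : D => inner ℂ x (((d - c : A) : H →L[ℂ] H) x)) atTop
        (𝓝 (inner ℂ x (((t - c : A) : H →L[ℂ] H) x))) := fun c x =>
    Tendsto.inner tendsto_const_nhds ((ht x).sub_const _)
  have hub : a ≤ t := ha.2 fun d hd => le_of_inner_sub_nonneg fun x => by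
    refine ge_of_tendsto (hlim d x) ?_
    filter_upwards [Ici_mem_atTop (⟨d, hd⟩ : D)] with e he
    exact inner_sub_nonneg he x
  have h1 : Tendsto (fun d : D => (inner ℂ x (((t - d : A) : H →L[ℂ] H) x)).re) atTop (𝓝 0) := by
    have h2 : Tendsto (fun d : D => inner ℂ x (((t - d : A) : H →L[ℂ] H) x)) atTop
        (𝓝 (inner ℂ x ((t : H →L[ℂ] H) x - (t : H →L[ℂ] H) x))) :=
      Tendsto.inner tendsto_const_nhds (tendsto_const_nhds.sub (ht x))
    rw [sub_self, inner_zero_right] at h2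
    exact (Complex.continuous_re.tendsto _).comp h2
  obtain ⟨d, hd⟩ := (h1.eventually_lt_const hε).exists
  refine ⟨d, d.2, lt_of_le_of_lt ?_ hd⟩
  have h3 := (Complex.le_def.1 (inner_sub_nonneg hub x)).1
  have h4 : (t - d : A) = (t - a) + (a - d) := by abel
  rw [h4]
  change _ ≤ (inner ℂ x (((t - a : A) : H →L[ℂ] H) x + ((a - d : A) : H →L[ℂ] H) x)).re
  rw [inner_add_right, Complex.add_re]
  exact le_add_of_nonneg_left h3

end Vigier

/-! ### Normality tested on vector states. -/

section Normal

variable {H K : Type u} [NormedAddCommGroup H] [InnerProductSpace ℂ H] [CompleteSpace H]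
  [NormedAddCommGroup K] [InnerProductSpace ℂ K] [CompleteSpace K]
  {A : VonNeumannAlgebra H} {B : VonNeumannAlgebra K}

/-- If `c` bounds `φ '' D`, then `⟪x, (c - φ a) x⟫` is a nonnegative number minus `⟪x, (φ a - φ d)
x⟫`, hence exceeds `-ε` for every `ε > 0`. -/
theorem scottContinuous_of_exists_inner_sub_lt {φ : A → B} (hφ : Monotone φ)
    (h : ∀ D : Set A, D.Nonempty → DirectedOn (· ≤ ·) D → ∀ a, IsLUB D a → ∀ x : K, ∀ ε : ℝ,
      0 < ε → ∃ d ∈ D, (inner ℂ x (((φ a - φ d : B) : K →L[ℂ] K) x)).re < ε) :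
    ScottContinuous φ := by
  intro D hne hdir a ha
  refine ⟨by rintro _ ⟨d, hd, rfl⟩; exact hφ (ha.1 hd), fun c hc => ?_⟩
  refine le_of_inner_sub_nonneg fun x => ?_
  have hsplit : ∀ d, inner ℂ x (((c - φ a : B) : K →L[ℂ] K) x)
      = inner ℂ x (((c - φ d : B) : K →L[ℂ] K) x)
        - inner ℂ x (((φ a - φ d : B) : K →L[ℂ] K) x) := fun d => by
    have : (c - φ a : B) = (c - φ d) - (φ a - φ d) := by abel
    rw [this]
    exact inner_sub_right _ _ _
  refine Complex.le_def.2 ⟨le_of_forall_pos_lt_add fun ε hε => ?_, ?_⟩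
  · obtain ⟨d, hd, hlt⟩ := h D hne hdir a ha x ε hε
    have h1 := (Complex.le_def.1 (inner_sub_nonneg (hc ⟨d, hd, rfl⟩) x)).1
    rw [hsplit d, Complex.sub_re]
    linarith
  · obtain ⟨d, hd⟩ := hne
    have h1 := (Complex.le_def.1 (inner_sub_nonneg (hc ⟨d, hd, rfl⟩) x)).2
    have h2 := (Complex.le_def.1 (inner_sub_nonneg (hφ (ha.1 hd)) x)).2
    rw [hsplit d, Complex.sub_im, ← h1, ← h2]
    simp

theorem exists_inner_sub_lt_of_scottContinuous {φ : A → B} (hφ : ScottContinuous φ)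
    {D : Set A} (hne : D.Nonempty) (hdir : DirectedOn (· ≤ ·) D) {a : A} (ha : IsLUB D a) (x : K)
    {ε : ℝ} (hε : 0 < ε) : ∃ d ∈ D, (inner ℂ x (((φ a - φ d : B) : K →L[ℂ] K) x)).re < ε := by
  obtain ⟨_, ⟨d, hd, rfl⟩, h⟩ := exists_inner_sub_lt (hne.image φ)
    (hdir.mono_comp hφ.monotone) (hφ hne hdir ha) x hε
  exact ⟨d, hd, h⟩

theorem scottContinuous_conjugate (p : A) : ScottContinuous fun a : A => star p * a * p := by
  refine scottContinuous_of_exists_inner_sub_lt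
    (fun a b hab => star_left_conjugate_le_conjugate hab p) ?_
  intro D hne hdir a ha x ε hε
  obtain ⟨d, hd, h⟩ := exists_inner_sub_lt hne hdir ha ((p : H →L[ℂ] H) x) hε
  refine ⟨d, hd, ?_⟩
  have h1 : star p * a * p - star p * d * p = star p * (a - d) * p := by
    rw [mul_sub, sub_mul]
  rw [h1]
  change (inner ℂ x (adjoint (p : H →L[ℂ] H)
    (((a - d : A) : H →L[ℂ] H) ((p : H →L[ℂ] H) x)))).re < ε
  rwa [adjoint_inner_right]

end Normal

/-! ### Complete positivity as positivity of the kernel `φ (a⋆ b)`. -/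

section CompletelyPositive

theorem exists_sub_eq_of_isSelfAdjoint {D : Type*} [NonUnitalCStarAlgebra D] [PartialOrder D]
    [StarOrderedRing D] {m : D} (hm : IsSelfAdjoint m) :
    ∃ p q : D, 0 ≤ p ∧ 0 ≤ q ∧ p - q = m ∧ p * q = 0 :=
  ⟨m⁺, m⁻, CFC.posPart_nonneg m, CFC.negPart_nonneg m, CFC.posPart_sub_negPart m hm,
    CFC.posPart_mul_negPart m⟩

theorem exists_eq_star_mul_self {D : Type*} [NonUnitalCStarAlgebra D] [PartialOrder D]
    [StarOrderedRing D] {m : D} (hm : 0 ≤ m) : ∃ s : D, m = star s * s :=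
  CStarAlgebra.nonneg_iff_eq_star_mul_self.1 hm

/-- Let `q` be the negative part of `M`. Then `q M q = -q³`, whose diagonal entries are values of
the form at columns of `q`, hence nonnegative. Since `q³` has the form `X⋆X`, its diagonal can be
nonpositive only if `X = 0`, so `q = 0`. -/
theorem cstarMatrix_nonneg_of_forall {C : Type*} [CStarAlgebra C] [PartialOrder C]
    [StarOrderedRing C] {n : Type} [Fintype n] [DecidableEq n] {M : CStarMatrix n n C}
    (hM : IsSelfAdjoint M)
    (h : ∀ v : n → C, 0 ≤ ∑ k, ∑ l, star (v k) * M k l * v l) : 0 ≤ M := by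
  obtain ⟨p, q, hp, hneg, hdec, hmul⟩ := exists_sub_eq_of_isSelfAdjoint hM
  have hsa : star q = q := (IsSelfAdjoint.of_nonneg hneg).star_eq
  have h1 : q * M * q = -(q * q * q) := by
    rw [← hdec, mul_assoc, sub_mul, hmul, zero_sub, mul_neg, mul_assoc]
  have h2 : 0 ≤ q * q * q := by
    have := star_left_conjugate_nonneg hneg q
    rwa [hsa] at this
  obtain ⟨X, hX⟩ := exists_eq_star_mul_self h2
  have h3 : ∀ i, (q * M * q) i i = ∑ k, ∑ l, star (q k i) * M k l * q l i := by
    intro i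
    have h4 : ∀ k, q i k = star (q k i) := fun k => by
      conv_lhs => rw [← hsa]
      rfl
    simp only [CStarMatrix.mul_apply, Finset.sum_mul, h4]
    exact Finset.sum_comm
  have h5 : ∀ i l, X l i = 0 := by
    intro i
    have h6 : ∑ l, star (X l i) * X l i ≤ 0 := by
      have h7 : (q * q * q) i i = ∑ l, star (X l i) * X l i := by
        rw [hX, CStarMatrix.mul_apply]
        rfl
      have h8 := h fun l => q l i
      rw [← h3, h1, CStarMatrix.neg_apply, h7] at h8
      exact neg_nonneg.1 h8
    have h9 : ∀ l ∈ Finset.univ, 0 ≤ star (X l i) * X l i := fun l _ => star_mul_self_nonneg _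
    have h10 := (Finset.sum_eq_zero_iff_of_nonneg h9).1 (le_antisymm h6 (Finset.sum_nonneg h9))
    exact fun l => CStarRing.star_mul_self_eq_zero_iff _ |>.1 (h10 l (Finset.mem_univ l))
  have hX0 : X = 0 := CStarMatrix.ext fun l i => h5 i l
  have h11 : q * q * q = 0 := by rw [hX, hX0, mul_zero]
  have h12 : q * q = 0 := by
    rw [← CStarRing.star_mul_self_eq_zero_iff, star_mul, hsa, ← mul_assoc, h11, zero_mul]
  have h13 : q = 0 := by
    rw [← CStarRing.star_mul_self_eq_zero_iff, hsa, h12]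
  rw [← hdec, h13, sub_zero]
  exact hp

variable {H K : Type u} [NormedAddCommGroup H] [InnerProductSpace ℂ H] [CompleteSpace H]
  [NormedAddCommGroup K] [InnerProductSpace ℂ K] [CompleteSpace K]
  {A : VonNeumannAlgebra H} {B : VonNeumannAlgebra K}

omit [CompleteSpace H] in
theorem sum_inner_nonneg_of_eq_sum_star_mul {n : Type*} [Fintype n]
    (T S : n → n → K →L[ℂ] K) (h : ∀ i j, T i j = ∑ l, star (S l i) * S l j) (x : n → K) :
    0 ≤ ∑ i, ∑ j, inner ℂ (x i) (T i j (x j)) := by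
  have h1 : ∀ i j, inner ℂ (x i) (T i j (x j)) = ∑ l, inner ℂ (S l i (x i)) (S l j (x j)) := by
    intro i j
    rw [h, sum_apply, inner_sum]
    refine Finset.sum_congr rfl fun l _ => ?_
    rw [star_eq_adjoint, mul_apply_eq_comp, adjoint_inner_right]
  simp only [h1]
  have h3 : ∑ i, ∑ j, ∑ l, inner ℂ (S l i (x i)) (S l j (x j))
      = ∑ l, ∑ i, ∑ j, inner ℂ (S l i (x i)) (S l j (x j)) :=
    (Finset.sum_congr rfl fun i _ => Finset.sum_comm).trans Finset.sum_comm
  rw [h3]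
  refine Finset.sum_nonneg fun l _ => ?_
  have h2 : ∑ i, ∑ j, inner ℂ (S l i (x i)) (S l j (x j))
      = inner ℂ (∑ i, S l i (x i)) (∑ j, S l j (x j)) := by
    rw [sum_inner]
    simp only [inner_sum]
  rw [h2, inner_self_eq_norm_sq_to_K]
  positivity

/-- The kernel `(a, b) ↦ φ (a⋆ b)` is positive semidefinite. For maps between von Neumann algebras
this is equivalent to complete positivity. -/
def IsKernelPositive (φ : A →ₗ[ℂ] B) : Prop :=
  ∀ (n : ℕ) (q : Fin n → A) (x : Fin n → K),
    0 ≤ ∑ i, ∑ j, inner ℂ (x i) ((φ (star (q i) * q j) : K →L[ℂ] K) (x j))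

theorem isKernelPositive_of_completelyPositive (f : CompletelyPositiveMap A B) :
    IsKernelPositive f.toLinearMap := by
  intro n q x
  let M : CStarMatrix (Fin n) (Fin n) A := CStarMatrix.ofMatrix fun i j => star (q i) * q j
  have hM : 0 ≤ M := by
    refine cstarMatrix_nonneg_of_forall ?_ fun v => ?_
    · refine CStarMatrix.ext fun i j => ?_
      change star (star (q j) * q i) = star (q i) * q j
      rw [star_mul, star_star]
    · have h : ∑ k, ∑ l, star (v k) * M k l * v l
          = star (∑ k, q k * v k) * ∑ l, q l * v l := by
        rw [star_sum, Finset.sum_mul_sum]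
        refine Finset.sum_congr rfl fun k _ => Finset.sum_congr rfl fun l _ => ?_
        change star (v k) * (star (q k) * q l) * v l = _
        rw [star_mul]
        simp only [mul_assoc]
      rw [h]
      exact star_mul_self_nonneg _
  obtain ⟨S, hS⟩ := exists_eq_star_mul_self (f.map_cstarMatrix_nonneg' n M hM)
  have h1 : ∀ i j, (f.toLinearMap (star (q i) * q j) : K →L[ℂ] K)
      = ∑ l, star (S l i : K →L[ℂ] K) * (S l j : K →L[ℂ] K) := by
    intro i j
    have h2 : f.toLinearMap (star (q i) * q j) = (star S * S) i j := by rw [← hS]; rfl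
    rw [h2, CStarMatrix.mul_apply, AddSubmonoidClass.coe_finsetSum]
    rfl
  exact sum_inner_nonneg_of_eq_sum_star_mul _ (fun l i => (S l i : K →L[ℂ] K)) h1 x

theorem IsNCP.isKernelPositive {φ : A →ₗ[ℂ] B} (hφ : IsNCP φ) : IsKernelPositive φ := by
  obtain ⟨f, rfl⟩ := hφ.completelyPositive
  exact isKernelPositive_of_completelyPositive f

namespace IsKernelPositive

variable {φ : A →ₗ[ℂ] B} (hφ : IsKernelPositive φ)
include hφ

theorem smul {c : ℝ} (hc : 0 ≤ c) : IsKernelPositive ((c : ℂ) • φ) := by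
  intro n q x
  have h : ∑ i, ∑ j, inner ℂ (x i) ((((c : ℂ) • φ) (star (q i) * q j) : K →L[ℂ] K) (x j))
      = c * ∑ i, ∑ j, inner ℂ (x i) ((φ (star (q i) * q j) : K →L[ℂ] K) (x j)) := by
    simp only [Finset.mul_sum]
    refine Finset.sum_congr rfl fun i _ => Finset.sum_congr rfl fun j _ => ?_
    exact inner_smul_right _ _ _
  rw [h]
  exact mul_nonneg (by exact_mod_cast hc) (hφ n q x)

theorem sum_nonneg {ι : Type*} (s : Finset ι) (q : ι → A) (x : ι → K) :
    0 ≤ ∑ i ∈ s, ∑ j ∈ s, inner ℂ (x i) ((φ (star (q i) * q j) : K →L[ℂ] K) (x j)) := by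
  have h := hφ s.card (fun i => q (s.equivFin.symm i)) fun i => x (s.equivFin.symm i)
  rw [← Finset.sum_coe_sort s]
  simp only [← Finset.sum_coe_sort s (fun j => inner ℂ _ ((φ (star _ * q j) : K →L[ℂ] K) (x j)))]
  rw [← s.equivFin.symm.sum_comp]
  simp only [← s.equivFin.symm.sum_comp
    (fun j : s => inner ℂ _ ((φ (star _ * q j) : K →L[ℂ] K) (x j)))]
  exact h

theorem inner_star_mul_self_nonneg (a : A) (x : K) :
    0 ≤ inner ℂ x ((φ (star a * a) : K →L[ℂ] K) x) := by
  simpa using hφ 1 (fun _ => a) fun _ => x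

theorem map_nonneg {a : A} (ha : 0 ≤ a) : 0 ≤ φ a := by
  obtain ⟨s, rfl⟩ := CStarAlgebra.nonneg_iff_eq_star_mul_self.1 ha
  exact nonneg_iff_inner.2 (hφ.inner_star_mul_self_nonneg s)

theorem monotone : Monotone φ := fun a b hab => by
  rw [← sub_nonneg, ← map_sub]
  exact hφ.map_nonneg (sub_nonneg.2 hab)

theorem two_nonneg (a b : A) (x y : K) :
    0 ≤ inner ℂ x ((φ (star a * a) : K →L[ℂ] K) x) + inner ℂ x ((φ (star a * b) : K →L[ℂ] K) y)
      + (inner ℂ y ((φ (star b * a) : K →L[ℂ] K) x)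
        + inner ℂ y ((φ (star b * b) : K →L[ℂ] K) y)) := by
  simpa [Fin.sum_univ_two] using hφ 2 ![a, b] ![x, y]

/-- Positivity on the pair `a, 1` includes the vanishing of an imaginary part; replacing `x` by `I •
x` yields the real part of the identity. -/
theorem inner_star (a : A) (x y : K) :
    inner ℂ x ((φ (star a) : K →L[ℂ] K) y)
      = starRingEnd ℂ (inner ℂ y ((φ a : K →L[ℂ] K) x)) := by
  have hd : ∀ (b : A) (z : K), (inner ℂ z ((φ (star b * b) : K →L[ℂ] K) z)).im = 0 := fun b z =>
    (Complex.le_def.1 (hφ.inner_star_mul_self_nonneg b z)).2.symm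
  have h : ∀ x' : K, (inner ℂ x' ((φ (star a) : K →L[ℂ] K) y)).im
      + (inner ℂ y ((φ a : K →L[ℂ] K) x')).im = 0 := by
    intro x'
    have h1 := (Complex.le_def.1 (hφ.two_nonneg a 1 x' y)).2
    simp only [Complex.add_im, hd, mul_one, star_one, one_mul] at h1
    have h2 := hd 1 y
    rw [star_one, one_mul] at h2
    rw [h2] at h1
    simp only [Complex.zero_im] at h1
    linarith
  have h3 := h (Complex.I • x)
  rw [inner_smul_left, ContinuousLinearMap.map_smul, inner_smul_right] at h3
  apply Complex.ext
  · rw [Complex.conj_re]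
    simp at h3
    linarith
  · have := h x
    rw [Complex.conj_im]
    linarith

theorem map_star (a : A) : φ (star a) = star (φ a) := by
  apply Subtype.ext
  ext x
  refine ext_inner_left ℂ fun y => ?_
  rw [hφ.inner_star]
  change _ = inner ℂ y (adjoint (φ a : K →L[ℂ] K) x)
  rw [adjoint_inner_right, inner_conj_symm]

/-- A positive matrix is `N⋆N`, so its entries are sums over `l` of kernels `star (N l i) * N l j`,
and kernel positivity applies for each `l`. -/
theorem completelyPositive : ∃ f : CompletelyPositiveMap A B, f.toLinearMap = φ := by
  refine ⟨⟨φ, fun k M hM => ?_⟩, rfl⟩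
  obtain ⟨N, hN⟩ := exists_eq_star_mul_self hM
  have hsa : star M = M := (IsSelfAdjoint.of_nonneg hM).star_eq
  refine cstarMatrix_nonneg_of_forall ?_ fun v => ?_
  · refine CStarMatrix.ext fun i j => ?_
    change star (φ (M j i)) = φ (M i j)
    rw [← hφ.map_star]
    exact congrArg φ (congrFun (congrFun hsa i) j)
  · refine nonneg_iff_inner.2 fun x => ?_
    have h1 : ∀ i j, M i j = ∑ l, star (N l i) * N l j := by
      intro i j
      rw [hN, CStarMatrix.mul_apply]
      rfl
    have h2 : inner ℂ x (((∑ i, ∑ j, star (v i) * (M.map φ) i j * v j : B) : K →L[ℂ] K) x)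
        = ∑ l, ∑ i, ∑ j, inner ℂ ((v i : K →L[ℂ] K) x)
          ((φ (star (N l i) * N l j) : K →L[ℂ] K) ((v j : K →L[ℂ] K) x)) := by
      have h3 : ∀ i j, inner ℂ x (((star (v i) * (M.map φ) i j * v j : B) : K →L[ℂ] K) x)
          = ∑ l, inner ℂ ((v i : K →L[ℂ] K) x)
            ((φ (star (N l i) * N l j) : K →L[ℂ] K) ((v j : K →L[ℂ] K) x)) := by
        intro i j
        rw [CStarMatrix.map_apply, h1, map_sum]
        change inner ℂ x (adjoint (v i : K →L[ℂ] K)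
          (((∑ l, φ (star (N l i) * N l j) : B) : K →L[ℂ] K) ((v j : K →L[ℂ] K) x))) = _
        rw [adjoint_inner_right, AddSubmonoidClass.coe_finsetSum, sum_apply, inner_sum]
      simp only [AddSubmonoidClass.coe_finsetSum, sum_apply, inner_sum, h3]
      exact (Finset.sum_congr rfl fun i _ => Finset.sum_comm).trans Finset.sum_comm
    exact h2 ▸ Finset.sum_nonneg fun l _ =>
      hφ k (fun i => N l i) fun i => (v i : K →L[ℂ] K) x

end IsKernelPositive

end CompletelyPositive

/-! ### The variational argument for extremality. -/

section Extremality

variable {H K : Type u} [NormedAddCommGroup H] [InnerProductSpace ℂ H] [CompleteSpace H]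
  [NormedAddCommGroup K] [InnerProductSpace ℂ K] [CompleteSpace K]
  {A : VonNeumannAlgebra H} {B : VonNeumannAlgebra K}

omit [CompleteSpace K] in
-- At `w = -r y` the linear term `-2 r ‖y‖²` beats the quadratic one once `r > 0` is small.
theorem eq_zero_of_forall_nonneg (T : K →L[ℂ] K) (y : K)
    (h : ∀ w, 0 ≤ (inner ℂ w (T w)).re + 2 * (inner ℂ w y).re) : y = 0 := by
  by_contra hne
  have hd : 0 < ‖y‖ ^ 2 := by positivity
  set β := (inner ℂ y (T y)).re with hβ
  set r := ‖y‖ ^ 2 / (|β| + 1) with hr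
  have hr0 : 0 < r := by positivity
  have h1 := h ((-r : ℂ) • y)
  rw [map_smul, inner_smul_left, inner_smul_right, inner_smul_left, inner_self_eq_norm_sq_to_K,
    ← Complex.ofReal_neg, Complex.conj_ofReal, Complex.re_ofReal_mul, Complex.re_ofReal_mul,
    Complex.re_ofReal_mul, ← hβ] at h1
  have h2 : (((‖y‖ : ℂ)) ^ 2).re = ‖y‖ ^ 2 := by norm_cast
  erw [h2] at h1
  have h3 : r * (|β| + 1) = ‖y‖ ^ 2 := div_mul_cancel₀ _ (by positivity)
  have h4 : r * (r * β) ≤ r * (r * |β|) := by gcongr; exact le_abs_self β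
  nlinarith [mul_pos hr0 hr0, mul_pos hr0 hd]

namespace IsKernelPositive

variable {φ : A →ₗ[ℂ] B} (hφ : IsKernelPositive φ)
include hφ

theorem re_nonneg (a : A) (x z : K) :
    0 ≤ (inner ℂ z ((φ 1 : K →L[ℂ] K) z)).re + 2 * (inner ℂ z ((φ a : K →L[ℂ] K) x)).re
      + (inner ℂ x ((φ (star a * a) : K →L[ℂ] K) x)).re := by
  have h := (Complex.le_def.1 (hφ.two_nonneg 1 a z x)).1
  simp only [Complex.add_re, mul_one, star_one, one_mul, Complex.zero_re] at h
  rw [hφ.inner_star, Complex.conj_re] at h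
  linarith

/-- The Kadison–Schwarz inequality. -/
theorem star_mul_le (h1 : φ 1 = 1) (a : A) : star (φ a) * φ a ≤ φ (star a * a) := by
  refine le_of_inner_sub_nonneg fun x => ?_
  have h2 := hφ.re_nonneg a x (-(φ a : K →L[ℂ] K) x)
  have h3 := (Complex.le_def.1 (hφ.inner_star_mul_self_nonneg a x)).2
  have h4 : inner ℂ x (((star (φ a) * φ a : B) : K →L[ℂ] K) x)
      = ((‖(φ a : K →L[ℂ] K) x‖ ^ 2 : ℝ) : ℂ) := by
    change inner ℂ x (adjoint (φ a : K →L[ℂ] K) ((φ a : K →L[ℂ] K) x)) = _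
    rw [adjoint_inner_right, inner_self_eq_norm_sq_to_K]
    norm_cast
  have h5 : inner ℂ x (((φ (star a * a) - star (φ a) * φ a : B) : K →L[ℂ] K) x)
      = inner ℂ x ((φ (star a * a) : K →L[ℂ] K) x) - ((‖(φ a : K →L[ℂ] K) x‖ ^ 2 : ℝ) : ℂ) := by
    rw [← h4]
    exact inner_sub_right _ _ _
  rw [h1] at h2
  change 0 ≤ (inner ℂ (-(φ a : K →L[ℂ] K) x) (-(φ a : K →L[ℂ] K) x)).re + _ + _ at h2
  rw [inner_neg_neg, inner_neg_left, inner_self_eq_norm_sq_to_K] at h2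
  have h6 : (((‖(φ a : K →L[ℂ] K) x‖ : ℂ)) ^ 2).re = ‖(φ a : K →L[ℂ] K) x‖ ^ 2 := by norm_cast
  rw [h5]
  refine Complex.le_def.2 ⟨?_, ?_⟩
  · rw [Complex.sub_re, Complex.ofReal_re, Complex.zero_re]
    simp only [Complex.neg_re] at h2
    erw [h6] at h2
    linarith
  · rw [Complex.sub_im, Complex.ofReal_im, sub_zero]
    exact h3

/-- Since `(a e)⋆(a e) ≤ ‖a⋆a‖ e`, the map kills `(a e)⋆(a e)`; the quadratic inequality `re_nonneg`
then loses its constant term and forces `φ (a e) x = 0`. -/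
theorem map_mul_eq_zero {e : A} (he : IsStarProjection e) (h : φ e = 0) (a : A) :
    φ (a * e) = 0 := by
  have h1 : φ (star (a * e) * (a * e)) = 0 := by
    refine le_antisymm ?_ (hφ.map_nonneg (star_mul_self_nonneg _))
    have h2 : star (a * e) * (a * e) ≤ ((‖star a * a‖ : ℝ) : ℂ) • e := by
      have h3 := CStarAlgebra.star_left_conjugate_le_norm_smul (a := e) (b := star a * a)
      rw [he.isSelfAdjoint.star_eq, he.isIdempotentElem.eq] at h3
      rw [star_mul, he.isSelfAdjoint.star_eq, Complex.coe_smul]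
      simpa only [mul_assoc] using h3
    have h4 := hφ.monotone h2
    rwa [map_smul, h, smul_zero] at h4
  apply Subtype.ext
  ext x
  refine eq_zero_of_forall_nonneg (φ 1 : K →L[ℂ] K) _ fun w => ?_
  have h5 := hφ.re_nonneg (a * e) x w
  rw [h1] at h5
  simpa using h5

theorem map_compress {e : A} (he : IsStarProjection e) (h : φ (1 - e) = 0) (a : A) :
    φ (e * a * e) = φ a := by
  have he' : IsStarProjection (1 - e) := he.one_sub
  have h1 : ∀ b, φ (b * (1 - e)) = 0 := hφ.map_mul_eq_zero he' h
  have h2 : φ ((1 - e) * (a * e)) = 0 := by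
    rw [← star_star ((1 - e) * (a * e)), hφ.map_star, star_mul,
      he'.isSelfAdjoint.star_eq, h1, star_zero]
  have h3 : a = e * a * e + (1 - e) * (a * e) + a * (1 - e) := by noncomm_ring
  conv_rhs => rw [h3, map_add, map_add, h1, h2, add_zero, add_zero]

end IsKernelPositive

/-- The core of the proof. `V` and `S` play the role of a Stinespring pair at the single element
`a`; no representation of `A` is required, and approximating `S V x` from the range of `V` is what
leaves no room for a splitting. -/
theorem eq_of_convex_combination {L : Type u} [NormedAddCommGroup L] [InnerProductSpace ℂ L]
    [CompleteSpace L] {φ₁ φ₂ φ : A →ₗ[ℂ] B} (hφ₁ : IsKernelPositive φ₁)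
    (hφ₂ : IsKernelPositive φ₂) {s t : ℝ} (hs : 0 < s) (ht : 0 < t) (hst : s + t = 1)
    (hφ : (s : ℂ) • φ₁ + (t : ℂ) • φ₂ = φ) (h₁ : φ₁ 1 = φ 1) (h₂ : φ₂ 1 = φ 1) {a : A}
    (V : K →L[ℂ] L) (S : L →L[ℂ] L) (hV : (φ 1 : K →L[ℂ] K) = adjoint V ∘L V)
    (hS : (φ a : K →L[ℂ] K) = adjoint V ∘L S ∘L V)
    (hSS : (φ (star a * a) : K →L[ℂ] K) = adjoint V ∘L adjoint S ∘L S ∘L V)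
    (hcl : ∀ x, S (V x) ∈ closure (Set.range V)) : φ₁ a = φ₂ a := by
  apply Subtype.ext
  ext x
  rw [← sub_eq_zero]
  set y := (φ₁ a : K →L[ℂ] K) x - (φ₂ a : K →L[ℂ] K) x with hy
  have hφe : ∀ b, (φ b : K →L[ℂ] K)
      = (s : ℂ) • (φ₁ b : K →L[ℂ] K) + (t : ℂ) • (φ₂ b : K →L[ℂ] K) := fun b => by
    rw [← hφ]; rfl
  have hre : ∀ b (z x : K), (inner ℂ z ((φ b : K →L[ℂ] K) x)).re
      = s * (inner ℂ z ((φ₁ b : K →L[ℂ] K) x)).re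
        + t * (inner ℂ z ((φ₂ b : K →L[ℂ] K) x)).re := by
    intro b z x
    rw [hφe]
    change (inner ℂ z ((s : ℂ) • (φ₁ b : K →L[ℂ] K) x + (t : ℂ) • (φ₂ b : K →L[ℂ] K) x)).re = _
    rw [inner_add_right, inner_smul_right, inner_smul_right, Complex.add_re,
      Complex.re_ofReal_mul, Complex.re_ofReal_mul]
  have hβ : ∀ z, (inner ℂ z ((φ 1 : K →L[ℂ] K) z)).re = ‖V z‖ ^ 2 := by
    intro z
    rw [hV, comp_apply, adjoint_inner_right, inner_self_eq_norm_sq_to_K]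
    norm_cast
  have hsq : ∀ u v : L, ‖u + v‖ ^ 2 = ‖u‖ ^ 2 + 2 * (inner ℂ u v).re + ‖v‖ ^ 2 := fun u v =>
    norm_add_sq (𝕜 := ℂ) u v
  have key : ∀ w : K, 0 ≤ ‖V w‖ ^ 2 + 2 * (inner ℂ w y).re := by
    intro w
    have h1 : ∀ z : K, 0 ≤ ‖V z + S (V x)‖ ^ 2
        + s * t * (‖V w‖ ^ 2 + 2 * (inner ℂ w y).re) := by
      intro z
      -- The shifts `t w` and `-s w` have weighted mean zero, so `s ‖V(z + t w)‖² + t ‖V(z - s w)‖²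
      -- = ‖V z‖² + s t ‖V w‖²` because `s + t = 1`.
      have e1 := hφ₁.re_nonneg a x (z + (t : ℂ) • w)
      have e2 := hφ₂.re_nonneg a x (z + (-s : ℂ) • w)
      have e3 := hre a z x
      have e4 := hre (star a * a) x x
      rw [h₁, hβ, map_add, hsq, map_smul, inner_smul_right, norm_smul, inner_add_left,
        inner_smul_left] at e1
      rw [h₂, hβ, map_add, hsq, map_smul, inner_smul_right, norm_smul, inner_add_left,
        inner_smul_left] at e2
      have e5 : (inner ℂ z ((φ a : K →L[ℂ] K) x)).re = (inner ℂ (V z) (S (V x))).re := by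
        rw [hS, comp_apply, adjoint_inner_right, comp_apply]
      have e6 : (inner ℂ x ((φ (star a * a) : K →L[ℂ] K) x)).re = ‖S (V x)‖ ^ 2 := by
        rw [hSS, comp_apply, adjoint_inner_right, comp_apply, adjoint_inner_right, comp_apply,
          inner_self_eq_norm_sq_to_K]
        norm_cast
      have e7 : (inner ℂ w y).re = (inner ℂ w ((φ₁ a : K →L[ℂ] K) x)).re
          - (inner ℂ w ((φ₂ a : K →L[ℂ] K) x)).re := by
        rw [hy, inner_sub_right, Complex.sub_re]
      have e8 : s = 1 - t := by linarith
      rw [hsq, e7, ← e5, ← e6, e3, e4]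
      simp only [Complex.add_re, Complex.re_ofReal_mul, Complex.conj_ofReal, Complex.norm_real,
        Real.norm_eq_abs, mul_pow, sq_abs, norm_neg, map_neg, neg_mul, Complex.neg_re] at e1 e2
      have e9 := add_nonneg (mul_nonneg hs.le e1) (mul_nonneg ht.le e2)
      subst e8
      linarith
    by_contra hneg
    push Not at hneg
    have hpos : 0 < -(s * t * (‖V w‖ ^ 2 + 2 * (inner ℂ w y).re)) := by
      have := mul_pos_of_neg_of_neg (neg_neg_of_pos (mul_pos hs ht)) hneg
      linarith
    obtain ⟨_, ⟨z, rfl⟩, hz⟩ := Metric.mem_closure_iff.1 (hcl x) _ (Real.sqrt_pos.2 hpos)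
    have h2 := h1 (-z)
    rw [dist_eq_norm] at hz
    have h3 : ‖V (-z) + S (V x)‖ ^ 2 < -(s * t * (‖V w‖ ^ 2 + 2 * (inner ℂ w y).re)) := by
      rw [map_neg, neg_add_eq_sub]
      calc _ < _ := pow_lt_pow_left₀ hz (norm_nonneg _) two_ne_zero
        _ = _ := Real.sq_sqrt hpos.le
    linarith
  exact eq_zero_of_forall_nonneg (φ 1 : K →L[ℂ] K) y fun w => by rw [hβ]; exact key w

end Extremality

/-! ### Range projections of operators between Hilbert spaces. -/

section RangeProjection

variable {K L : Type u} [NormedAddCommGroup K] [InnerProductSpace ℂ K]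
  [NormedAddCommGroup L] [InnerProductSpace ℂ L] [CompleteSpace L]

/-- The projection onto the closure of the range of `V`. -/
noncomputable def rangeProjection (V : K →L[ℂ] L) : L →L[ℂ] L :=
  V.range.topologicalClosure.starProjection

variable (V : K →L[ℂ] L)

theorem isStarProjection_rangeProjection : IsStarProjection (rangeProjection V) :=
  isStarProjection_starProjection

theorem rangeProjection_comp : rangeProjection V ∘L V = V := by
  ext x
  exact Submodule.starProjection_eq_self_iff.2 (subset_closure ⟨x, rfl⟩)

theorem rangeProjection_apply_mem (x : L) : rangeProjection V x ∈ closure (Set.range V) :=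
  V.range.topologicalClosure.starProjection_apply_mem x

theorem comp_rangeProjection_eq_zero {T : L →L[ℂ] L} (h : T ∘L V = 0) :
    T * rangeProjection V = 0 := by
  ext x
  have h1 : Set.EqOn T 0 (closure (Set.range V)) := by
    refine Set.EqOn.closure ?_ T.continuous continuous_zero
    rintro _ ⟨y, rfl⟩
    exact congrArg (fun S : K →L[ℂ] L => S y) h
  exact h1 (rangeProjection_apply_mem V x)

/-- Both `S` and its adjoint leave the range of `V` invariant, so its closure reduces `S`. -/
theorem rangeProjection_commute {S : L →L[ℂ] L} {b c : K →L[ℂ] K} (h : S ∘L V = V ∘L b)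
    (h' : adjoint S ∘L V = V ∘L c) : S * rangeProjection V = rangeProjection V * S := by
  have h1 : ∀ (T : L →L[ℂ] L) (d : K →L[ℂ] K), T ∘L V = V ∘L d →
      rangeProjection V * T * rangeProjection V = T * rangeProjection V := by
    intro T d hT
    have h2 : (rangeProjection V * T - T) ∘L V = 0 := by
      rw [sub_comp]
      change rangeProjection V ∘L (T ∘L V) - T ∘L V = 0
      rw [hT, ← comp_assoc, rangeProjection_comp, sub_self]
    have h3 := comp_rangeProjection_eq_zero V h2
    rwa [sub_mul, sub_eq_zero] at h3
  have h4 := congrArg star (h1 _ c h')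
  have hsa := (isStarProjection_rangeProjection V).isSelfAdjoint.star_eq
  rw [star_mul, star_mul, star_mul, hsa, star_eq_adjoint, adjoint_adjoint, ← mul_assoc,
    h1 S b h] at h4
  exact h4

end RangeProjection

/-! ### Extremality without normality; ⋆-homomorphisms. -/

section Extreme

variable {H K : Type u} [NormedAddCommGroup H] [InnerProductSpace ℂ H] [CompleteSpace H]
  [NormedAddCommGroup K] [InnerProductSpace ℂ K] [CompleteSpace K]
  {A : VonNeumannAlgebra H} {B : VonNeumannAlgebra K}

/-- A convex decomposition of `φ` into kernel positive maps with the same value at `1` is trivial;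
in contrast with `IsNCPExtreme` no normality is involved. -/
def IsCPExtreme (φ : A →ₗ[ℂ] B) : Prop :=
  ∀ φ₁ φ₂ : A →ₗ[ℂ] B, IsKernelPositive φ₁ → IsKernelPositive φ₂ → φ₁ 1 = φ 1 → φ₂ 1 = φ 1 →
    ∀ s t : ℝ, 0 < s → 0 < t → s + t = 1 → (s : ℂ) • φ₁ + (t : ℂ) • φ₂ = φ → φ₁ = φ₂

theorem IsCPExtreme.isNCPExtreme {φ : A →ₗ[ℂ] B} (h : IsCPExtreme φ) (hφ : IsNCP φ) :
    IsNCPExtreme φ := by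
  refine mem_extremePoints_iff_left.2 ⟨⟨hφ, rfl⟩, ?_⟩
  rintro φ₁ ⟨hφ₁, h₁⟩ φ₂ ⟨hφ₂, h₂⟩ ⟨s, t, hs, ht, hst, he⟩
  have he' : (s : ℂ) • φ₁ + (t : ℂ) • φ₂ = φ := by
    rw [← he]
    rfl
  have h12 := h φ₁ φ₂ hφ₁.isKernelPositive hφ₂.isKernelPositive h₁ h₂ s t hs ht hst he'
  rw [← he', ← h12, ← add_smul, ← Complex.ofReal_add, hst, Complex.ofReal_one, one_smul]

theorem isNCP_linearMapOfHom {ϱ : A →⋆ₐ[ℂ] B} (h : IsNMIU ϱ) : IsNCP (linearMapOfHom ϱ) where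
  completelyPositive := ⟨CompletelyPositiveMapClass.toCompletelyPositiveLinearMap ϱ, rfl⟩
  normal := h

theorem isCPExtreme_linearMapOfHom (ϱ : A →⋆ₐ[ℂ] B) : IsCPExtreme (linearMapOfHom ϱ) := by
  intro φ₁ φ₂ hφ₁ hφ₂ h₁ h₂ s t hs ht hst hφ
  ext1 a
  have h1 : adjoint (1 : K →L[ℂ] K) = 1 := star_one _
  refine eq_of_convex_combination hφ₁ hφ₂ hs ht hst hφ h₁ h₂ 1 (ϱ a : K →L[ℂ] K) ?_ ?_ ?_ ?_
  · rw [h1]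
    exact congrArg Subtype.val (map_one ϱ)
  · rw [h1]
    rfl
  · rw [h1]
    exact congrArg Subtype.val ((map_mul ϱ _ _).trans (congrArg (· * ϱ a) (map_star ϱ a)))
  · intro x
    exact subset_closure ⟨(ϱ a : K →L[ℂ] K) x, rfl⟩

theorem eq_zero_of_smul_add_smul_eq_zero {s t : ℝ} (hs : 0 < s) (ht : 0 < t) {x y : B}
    (hx : 0 ≤ x) (hy : 0 ≤ y) (h : (s : ℂ) • x + (t : ℂ) • y = 0) : x = 0 := by
  have hsx : 0 ≤ (s : ℂ) • x := by
    rw [Complex.coe_smul]; exact smul_nonneg hs.le hx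
  have hty : 0 ≤ (t : ℂ) • y := by
    rw [Complex.coe_smul]; exact smul_nonneg ht.le hy
  have h1 : (s : ℂ) • x = 0 := ((add_eq_zero_iff_of_nonneg hsx hty).1 h).1
  exact (smul_eq_zero.1 h1).resolve_left (by exact_mod_cast hs.ne')

end Extreme

/-! ### Pure maps. -/

section Pure

variable {H K : Type u} [NormedAddCommGroup H] [InnerProductSpace ℂ H] [CompleteSpace H]
  [NormedAddCommGroup K] [InnerProductSpace ℂ K] [CompleteSpace K]
  {A : VonNeumannAlgebra H} {B : VonNeumannAlgebra K}

theorem extendOp_standardCorner (p : A.Proj) (a : A) :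
    extendOp p.space (A.standardCorner p a : p.space →L[ℂ] p.space)
      = p.op * (a : H →L[ℂ] H) * p.op := by
  change extendOp p.space (compressOp p.space _) = _
  rw [extendOp_compressOp, p.starProjection_space]

omit [CompleteSpace H] in
theorem extendOp_injective (U : Submodule ℂ H) [U.HasOrthogonalProjection] :
    Function.Injective (extendOp U) := fun S T h => by
  rw [← compressOp_extendOp U S, h, compressOp_extendOp]

theorem standardCorner_one (p : A.Proj) : A.standardCorner p 1 = 1 := by
  refine Subtype.ext (extendOp_injective p.space ?_)
  rw [extendOp_standardCorner]
  change p.op * 1 * p.op = extendOp p.space 1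
  rw [extendOp_one, p.starProjection_space, mul_one, p.isStarProjection_op.isIdempotentElem.eq]

theorem standardCorner_one_sub (p : A.Proj) : A.standardCorner p (1 - p.val) = 0 := by
  have h : A.standardCorner p p.val = 1 := by
    refine Subtype.ext (extendOp_injective p.space ?_)
    rw [extendOp_standardCorner]
    change p.op * p.op * p.op = extendOp p.space 1
    rw [extendOp_one, p.starProjection_space, p.isStarProjection_op.isIdempotentElem.eq,
      p.isStarProjection_op.isIdempotentElem.eq]
  rw [map_sub, standardCorner_one, h, sub_self]

theorem standardCorner_star_mul_self (p : A.Proj) {a : A} (ha : p.val * a = a) :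
    A.standardCorner p (star a * a) = star (A.standardCorner p a) * A.standardCorner p a := by
  refine Subtype.ext (extendOp_injective p.space ?_)
  rw [extendOp_standardCorner]
  change _ = extendOp p.space (star (A.standardCorner p a : p.space →L[ℂ] p.space)
    * (A.standardCorner p a : p.space →L[ℂ] p.space))
  have ha' : p.op * (a : H →L[ℂ] H) = a := congrArg Subtype.val ha
  have hp := p.isStarProjection_op.isSelfAdjoint.star_eq
  rw [extendOp_mul, extendOp_star, extendOp_standardCorner, ha', star_mul, hp]
  change p.op * (star (a : H →L[ℂ] H) * (a : H →L[ℂ] H)) * p.op = _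
  simp only [mul_assoc]

/-- Kadison–Schwarz for `ψ` gives one inequality; Kadison–Schwarz for the inverse at `ψ a`, pushed
forward by `ψ`, gives the other. -/
theorem IsNCPIso.map_star_mul_self {ψ : A →ₗ[ℂ] B} (hψ : IsNCPIso ψ) (h1 : ψ 1 = 1) (a : A) :
    ψ (star a * a) = star (ψ a) * ψ a := by
  obtain ⟨hψ, χ, hχ, hχψ, hψχ⟩ := hψ
  have e1 : ∀ x, χ (ψ x) = x := fun x => congrArg (fun f : A →ₗ[ℂ] A => f x) hχψ
  have e2 : ∀ x, ψ (χ x) = x := fun x => congrArg (fun f : B →ₗ[ℂ] B => f x) hψχ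
  have hχ1 : χ 1 = 1 := by rw [← h1, e1]
  refine le_antisymm ?_ (hψ.isKernelPositive.star_mul_le h1 a)
  have h2 := hχ.isKernelPositive.star_mul_le hχ1 (ψ a)
  rw [e1] at h2
  have h3 := hψ.isKernelPositive.monotone h2
  rwa [e2] at h3

theorem IsSupportProj.sqrt_mul_op {b : B} {q : B.Proj} (hq : IsSupportProj b q) (hb : 0 ≤ b) :
    CFC.sqrt (b : K →L[ℂ] K) * q.op = CFC.sqrt (b : K →L[ℂ] K) := by
  have hqp := q.isStarProjection_op
  have hb0 : (0 : K →L[ℂ] K) ≤ b := hb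
  have hdsa : star (CFC.sqrt (b : K →L[ℂ] K)) = CFC.sqrt (b : K →L[ℂ] K) :=
    (IsSelfAdjoint.of_nonneg (CFC.sqrt_nonneg _)).star_eq
  have h := (hqp.mul_right_and_mul_left_of_nonneg_of_le hb0 hq.1.2).1
  rw [← sub_eq_zero, ← CStarRing.star_mul_self_eq_zero_iff, star_sub, star_mul, hdsa,
    hqp.isSelfAdjoint.star_eq, sub_mul, mul_sub, mul_sub, mul_assoc, ← mul_assoc _ _ q.op,
    CFC.sqrt_mul_sqrt_self _ hb0, mul_assoc, CFC.sqrt_mul_sqrt_self _ hb0]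
  simp [h]

/-- The range projection `r` of `√b` lies in `B`, since it commutes with the commutant. As `b ≤ q ≤
1`, conjugating `b ≤ 1` by `r` gives `b ≤ r`, and minimality of `q` yields `q ≤ r`. -/
theorem IsSupportProj.rangeProjection_mul_op {b : B} {q : B.Proj} (hq : IsSupportProj b q)
    (hb : 0 ≤ b) : rangeProjection (CFC.sqrt (b : K →L[ℂ] K)) * q.op = q.op := by
  have hb0 : (0 : K →L[ℂ] K) ≤ b := hb
  set d := CFC.sqrt (b : K →L[ℂ] K) with hd
  have hdd : d * d = b := CFC.sqrt_mul_sqrt_self _ hb0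
  have hdsa : star d = d := (IsSelfAdjoint.of_nonneg (CFC.sqrt_nonneg _)).star_eq
  have hqp := q.isStarProjection_op
  have hrp := isStarProjection_rangeProjection d
  have hrB : rangeProjection d ∈ B := by
    rw [← B.commutant_commutant, mem_commutant_iff]
    intro g hg
    have hdg : ∀ g' ∈ B.commutant, g' ∘L d = d ∘L g' := fun g' hg' =>
      (mem_commutant_iff.1 hg' d (B.sqrt_mem b.2)).symm
    exact rangeProjection_commute d (hdg g hg) (hdg _ (star_mem hg))
  have hb1 : (b : K →L[ℂ] K) ≤ 1 :=
    le_trans (b := q.op) hq.1.2 hqp.le_one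
  have hrd : rangeProjection d * d = d := rangeProjection_comp d
  have hdr : d * rangeProjection d = d := by
    have := congrArg star hrd
    rwa [star_mul, hrp.isSelfAdjoint.star_eq, hdsa] at this
  have hbr : (b : K →L[ℂ] K) ≤ rangeProjection d := by
    have h := star_left_conjugate_le_conjugate hb1 (rangeProjection d)
    rw [hrp.isSelfAdjoint.star_eq, mul_one, hrp.isIdempotentElem.eq, ← hdd, ← mul_assoc, hrd,
      mul_assoc, hdr, hdd] at h
    exact h
  have hqr : q.val ≤ (⟨rangeProjection d, hrB⟩ : B) :=
    hq.2 ⟨⟨Subtype.ext hrp.isIdempotentElem.eq, Subtype.ext hrp.isSelfAdjoint.star_eq⟩, hbr⟩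
  exact (hqp.le_iff_mul_eq_right hrp).1 hqr

/-- The closure of the range of `d` contains that of `q`, so `d` can be cancelled on the right of
`T`, and on the left after taking adjoints. -/
theorem eq_zero_of_sandwich {d q T : H →L[ℂ] H} (hd : star d = d)
    (hrq : rangeProjection d * q = q) (hq : star q = q) (hqT : q * T = T) (hTq : T * q = T)
    (h : d * T * d = 0) : T = 0 := by
  have hrsa := (isStarProjection_rangeProjection d).isSelfAdjoint.star_eq
  have h1 : d * T * q = 0 := by
    rw [← hrq, ← mul_assoc, comp_rangeProjection_eq_zero d (T := d * T) h, zero_mul]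
  rw [mul_assoc, hTq] at h1
  have h2 : star T * rangeProjection d = 0 := by
    refine comp_rangeProjection_eq_zero d ?_
    have h3 := congrArg star h1
    rwa [star_mul, hd, star_zero] at h3
  have h4 : star T * q = 0 := by rw [← hrq, ← mul_assoc, h2, zero_mul]
  have h5 := congrArg star h4
  rwa [star_mul, star_star, hq, hqT, star_zero] at h5

theorem Proj.op_mul_extendOp (q : B.Proj) (T : q.space →L[ℂ] q.space) :
    q.op * extendOp q.space T = extendOp q.space T := by
  rw [← q.starProjection_space, ← extendOp_one, ← extendOp_mul, one_mul]

theorem Proj.extendOp_mul_op (q : B.Proj) (T : q.space →L[ℂ] q.space) :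
    extendOp q.space T * q.op = extendOp q.space T := by
  rw [← q.starProjection_space, ← extendOp_one, ← extendOp_mul, mul_one]

theorem IsPureContractive.isCPExtreme {φ : A →ₗ[ℂ] B} (hφ : IsPureContractive φ) :
    IsCPExtreme φ := by
  obtain ⟨p, q, hp, hq, ψ, hψ, hfac⟩ := hφ
  intro φ₁ φ₂ hφ₁ hφ₂ h₁ h₂ s t hs ht hst hφ
  have hb0 : 0 ≤ φ 1 := by
    rw [← h₁]; exact hφ₁.map_nonneg zero_le_one
  have hrq := hq.rangeProjection_mul_op hb0
  have hdq := hq.sqrt_mul_op hb0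
  have hfac' : ∀ a, (φ a : K →L[ℂ] K) = CFC.sqrt (φ 1 : K →L[ℂ] K)
      * extendOp q.space (ψ (A.standardCorner p a) : q.space →L[ℂ] q.space)
      * CFC.sqrt (φ 1 : K →L[ℂ] K) := fun a =>
    congrArg (fun f : A →ₗ[ℂ] B => (f a : K →L[ℂ] K)) hfac.symm
  have hdd : CFC.sqrt (φ 1 : K →L[ℂ] K) * CFC.sqrt (φ 1 : K →L[ℂ] K) = φ 1 :=
    CFC.sqrt_mul_sqrt_self _ (show (0 : K →L[ℂ] K) ≤ φ 1 from hb0)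
  have hdsa : star (CFC.sqrt (φ 1 : K →L[ℂ] K)) = CFC.sqrt (φ 1 : K →L[ℂ] K) :=
    (IsSelfAdjoint.of_nonneg (CFC.sqrt_nonneg _)).star_eq
  have hqp := q.isStarProjection_op
  generalize CFC.sqrt (φ 1 : K →L[ℂ] K) = d at *
  -- Unitality is not assumed: with `d = √(φ 1)`, `d (ψ 1 - q) d = φ 1 - d² = 0`, and `d` can be
  -- cancelled on the corner of `q`.
  have hψ1 : ψ 1 = 1 := by
    refine Subtype.ext (extendOp_injective q.space ?_)
    change _ = extendOp q.space 1
    rw [extendOp_one, q.starProjection_space, ← sub_eq_zero]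
    refine eq_zero_of_sandwich hdsa hrq hqp.isSelfAdjoint.star_eq ?_ ?_ ?_
    · rw [mul_sub, q.op_mul_extendOp, hqp.isIdempotentElem.eq]
    · rw [sub_mul, q.extendOp_mul_op, hqp.isIdempotentElem.eq]
    · rw [mul_sub, sub_mul, ← standardCorner_one, ← hfac', hdq, hdd, sub_self]
  have hφe : φ (1 - p.val) = 0 := by
    rw [← hfac]
    simp [standardCorner_one_sub]
  have hφe' : (s : ℂ) • φ₁ (1 - p.val) + (t : ℂ) • φ₂ (1 - p.val) = 0 := by
    rw [← hφe, ← hφ]; rfl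
  have hpn : 0 ≤ 1 - p.val := p.isStarProjection.one_sub.nonneg
  have hz₁ : φ₁ (1 - p.val) = 0 :=
    eq_zero_of_smul_add_smul_eq_zero hs ht (hφ₁.map_nonneg hpn) (hφ₂.map_nonneg hpn) hφe'
  have hz₂ : φ₂ (1 - p.val) = 0 :=
    eq_zero_of_smul_add_smul_eq_zero ht hs (hφ₂.map_nonneg hpn) (hφ₁.map_nonneg hpn)
      ((add_comm _ _).trans hφe')
  ext1 a
  -- Both summands vanish on `1 - p`, so `a` may be replaced by `pap`, on which the standard corner
  -- respects `a⋆a`.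
  rw [← hφ₁.map_compress p.isStarProjection hz₁, ← hφ₂.map_compress p.isStarProjection hz₂]
  have hpa : p.val * (p.val * a * p.val) = p.val * a * p.val := by
    rw [← mul_assoc, ← mul_assoc, p.isStarProjection.isIdempotentElem.eq]
  generalize p.val * a * p.val = a' at hpa
  have hSS : extendOp q.space
        (ψ (A.standardCorner p (star a' * a')) : q.space →L[ℂ] q.space)
      = star (extendOp q.space (ψ (A.standardCorner p a') : q.space →L[ℂ] q.space))
        * extendOp q.space (ψ (A.standardCorner p a') : q.space →L[ℂ] q.space) := by
    rw [standardCorner_star_mul_self p hpa, hψ.map_star_mul_self hψ1, ← extendOp_star,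
      ← extendOp_mul]
    rfl
  refine eq_of_convex_combination hφ₁ hφ₂ hs ht hst hφ h₁ h₂ d
    (extendOp q.space (ψ (A.standardCorner p a') : q.space →L[ℂ] q.space)) ?_ ?_ ?_ ?_
  · rw [← star_eq_adjoint, hdsa]
    exact hdd.symm
  · rw [← star_eq_adjoint, hdsa, hfac', mul_assoc]
    rfl
  · refine ((hfac' _).trans (congrArg (fun T => d * T * d) hSS)).trans ?_
    generalize extendOp q.space (ψ (A.standardCorner p a') : q.space →L[ℂ] q.space) = S
    rw [show adjoint d = d from hdsa, mul_assoc, mul_assoc]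
    rfl
  · intro x
    rw [← q.op_mul_extendOp, ← hrq, mul_assoc]
    exact rangeProjection_apply_mem d _

theorem IsPure.isCPExtreme {φ : A →ₗ[ℂ] B} (hφ : IsPure φ) : IsCPExtreme φ := by
  intro φ₁ φ₂ hφ₁ hφ₂ h₁ h₂ s t hs ht hst he
  -- Here `‖φ 1‖⁻¹` is `0` and rescaling would lose all information; instead `φ₁ 1 = φ₂ 1 = 0` makes
  -- both maps vanish.
  by_cases h0 : φ 1 = 0
  · ext1 a
    rw [← mul_one a, hφ₁.map_mul_eq_zero (.one A) (h₁.trans h0),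
      hφ₂.map_mul_eq_zero (.one A) (h₂.trans h0)]
  · have hc : 0 < ‖φ 1‖⁻¹ := inv_pos.2 (norm_pos_iff.2 h0)
    have hc' : ((‖φ 1‖⁻¹ : ℝ) : ℂ) ≠ 0 := by exact_mod_cast hc.ne'
    have h := IsPureContractive.isCPExtreme hφ _ _ (hφ₁.smul hc.le) (hφ₂.smul hc.le)
      (congrArg (((‖φ 1‖⁻¹ : ℝ) : ℂ) • ·) h₁) (congrArg (((‖φ 1‖⁻¹ : ℝ) : ℂ) • ·) h₂) s t hs ht hst
      (by rw [smul_comm, smul_comm (t : ℂ), ← smul_add, he])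
    exact smul_right_injective _ hc' h

end Pure

/-! ### The minimal dilation of a kernel positive map. -/

section Dilation

variable {H K : Type u} [NormedAddCommGroup H] [InnerProductSpace ℂ H] [CompleteSpace H]
  [NormedAddCommGroup K] [InnerProductSpace ℂ K] [CompleteSpace K]
  {A : VonNeumannAlgebra H} {B : VonNeumannAlgebra K}

theorem exists_continuousLinearMap_of_norm_le {ι E F : Type*} [NormedAddCommGroup E]
    [NormedSpace ℂ E] [NormedAddCommGroup F] [NormedSpace ℂ F] [CompleteSpace F] {v : ι → E}
    (w : ι → F) (hv : Dense (Submodule.span ℂ (Set.range v) : Set E)) (C : ℝ)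
    (h : ∀ (s : Finset ι) (c : ι → ℂ), ‖∑ i ∈ s, c i • w i‖ ≤ C * ‖∑ i ∈ s, c i • v i‖) :
    ∃ T : E →L[ℂ] F, ∀ i, T (v i) = w i := by
  have hd : DenseRange (Finsupp.linearCombination ℂ v) := by
    rw [← Finsupp.range_linearCombination] at hv
    exact hv
  refine ⟨(Finsupp.linearCombination ℂ w).extendOfNorm (Finsupp.linearCombination ℂ v),
    fun i => ?_⟩
  have h1 := LinearMap.extendOfNorm_eq (f := Finsupp.linearCombination ℂ w) hd
    ⟨C, fun c => by simpa [Finsupp.linearCombination_apply, Finsupp.sum] using h c.support c⟩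
    (Finsupp.single i 1)
  simpa using h1

/-- Factoring the positive defect `‖a‖² - a⋆a` turns norm bounds on the dilation space into
identities between kernel sums, for `A` and for the commutant of `B` alike. -/
theorem exists_star_mul_self_add_eq {D : Type*} [CStarAlgebra D] [PartialOrder D]
    [StarOrderedRing D] (a : D) :
    ∃ r : D, star r * r + star a * a = ((‖a‖ ^ 2 : ℝ) : ℂ) • (1 : D) := by
  have h : star a * a ≤ ((‖a‖ ^ 2 : ℝ) : ℂ) • (1 : D) := by
    have h1 := CStarAlgebra.star_mul_le_algebraMap_norm_sq (a := a)
    rwa [Algebra.algebraMap_eq_smul_one, ← Complex.coe_smul] at h1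
  obtain ⟨r, hr⟩ := exists_eq_star_mul_self (sub_nonneg.2 h)
  exact ⟨r, by rw [← hr, sub_add_cancel]⟩

theorem inner_commutant_commutant (c : A.commutant) (a : A) (x y : H) :
    inner ℂ ((c : H →L[ℂ] H) x) ((a : H →L[ℂ] H) ((c : H →L[ℂ] H) y))
      = inner ℂ x (((star c * c : A.commutant) : H →L[ℂ] H) ((a : H →L[ℂ] H) y)) := by
  have h2 := mem_commutant_iff.1 c.2 _ a.2
  change _ = inner ℂ x (adjoint (c : H →L[ℂ] H) ((c : H →L[ℂ] H) ((a : H →L[ℂ] H) y)))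
  rw [adjoint_inner_right]
  exact congrArg (fun T : H →L[ℂ] H => inner ℂ ((c : H →L[ℂ] H) x) (T y)) h2

/-- A minimal Kolmogorov decomposition `⟪γ p x, γ q y⟫ = ⟪x, φ (p⋆ q) y⟫` of the kernel of `φ`. -/
structure KernelDilation (φ : A →ₗ[ℂ] B) (L : Type u) [NormedAddCommGroup L]
    [InnerProductSpace ℂ L] where
  /-- the maps into the dilation space -/
  γ : A → K →L[ℂ] L
  inner_γ : ∀ p q x y, inner ℂ (γ p x) (γ q y) = inner ℂ x ((φ (star p * q) : K →L[ℂ] K) y)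
  dense : Dense (Submodule.span ℂ (Set.range fun i : A × K => γ i.1 i.2) : Set L)

/-- The reproducing kernel Hilbert space of the operator-valued kernel `φ (p⋆ q)` provides the
decomposition, with `γ` its kernel functions. -/
theorem IsKernelPositive.exists_kernelDilation {φ : A →ₗ[ℂ] B} (hφ : IsKernelPositive φ) :
    ∃ (L : Type u) (_ : NormedAddCommGroup L) (_ : InnerProductSpace ℂ L) (_ : CompleteSpace L),
      Nonempty (KernelDilation φ L) := by
  let k : Matrix A A (K →L[ℂ] K) := Matrix.of fun p q => (φ (star p * q) : K →L[ℂ] K)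
  have hherm : k.IsHermitian := by
    ext1 p q
    change star ((φ (star q * p) : B) : K →L[ℂ] K) = (φ (star p * q) : B)
    have h := hφ.map_star (star q * p)
    rw [star_mul, star_star] at h
    exact (congrArg Subtype.val h).symm
  have hk : k.PosSemidef := by
    have htfae := (RKHS.posSemidef_tfae (K := k)).out 0 2
    refine htfae.2 ⟨hherm, fun v => ?_⟩
    have h := (Complex.le_def.1 (hφ.sum_nonneg v.support id v)).1
    have h1 : (v.sum fun x w => v.sum fun x' w' => inner ℂ (k x' x w) w')
        = starRingEnd ℂ (∑ i ∈ v.support, ∑ j ∈ v.support,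
          inner ℂ (v i) ((φ (star (id i) * id j) : K →L[ℂ] K) (v j))) := by
      simp only [Finsupp.sum, map_sum, inner_conj_symm]
      exact Finset.sum_comm
    rw [h1]
    change 0 ≤ (starRingEnd ℂ _).re
    rw [Complex.conj_re]
    exact h
  have : Fact k.PosSemidef := ⟨hk⟩
  refine ⟨RKHS.OfKernel k, inferInstance, inferInstance, inferInstance,
    ⟨⟨RKHS.kerFun (RKHS.OfKernel k), fun p q x y => ?_, ?_⟩⟩⟩
  · rw [← RKHS.kernel_inner, RKHS.OfKernel.kernel_ofKernel]
    change inner ℂ ((φ (star q * p) : K →L[ℂ] K) x) y = _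
    have h := hφ.inner_star (star q * p) x y
    rw [star_mul, star_star, inner_conj_symm] at h
    exact h.symm
  · have h := RKHS.kerFun_dense (RKHS.OfKernel k)
    rw [← Submodule.dense_iff_topologicalClosure_eq_top] at h
    have hr : (Set.range fun i : A × K => RKHS.kerFun (RKHS.OfKernel k) i.1 i.2)
        = {RKHS.kerFun (RKHS.OfKernel k) p x | (p) (x)} :=
      Set.ext fun z => ⟨fun ⟨⟨p, x⟩, h⟩ => ⟨p, x, h⟩, fun ⟨p, x, h⟩ => ⟨(p, x), h⟩⟩
    rw [hr]
    exact h

namespace KernelDilation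

variable {L : Type u} [NormedAddCommGroup L] [InnerProductSpace ℂ L] {φ : A →ₗ[ℂ] B}
  (D : KernelDilation φ L)

theorem ext_clm {F : Type*} [NormedAddCommGroup F] [NormedSpace ℂ F] {S T : L →L[ℂ] F}
    (h : ∀ p x, S (D.γ p x) = T (D.γ p x)) : S = T := by
  refine ContinuousLinearMap.ext_on D.dense ?_
  rintro _ ⟨⟨p, x⟩, rfl⟩
  exact h p x

theorem ext_inner {m n : L} (h : ∀ p x, inner ℂ m (D.γ p x) = inner ℂ n (D.γ p x)) : m = n := by
  have h1 : innerSL ℂ m = innerSL ℂ n := D.ext_clm fun p x => h p x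
  exact (innerSL_inj (𝕜 := ℂ)).1 h1

theorem norm_sq_sum {ι : Type*} (s : Finset ι) (q : ι → A) (x : ι → K) :
    ((‖∑ i ∈ s, D.γ (q i) (x i)‖ ^ 2 : ℝ) : ℂ)
      = ∑ i ∈ s, ∑ j ∈ s, inner ℂ (x i) ((φ (star (q i) * q j) : K →L[ℂ] K) (x j)) := by
  have h := inner_self_eq_norm_sq_to_K (𝕜 := ℂ) (∑ i ∈ s, D.γ (q i) (x i))
  rw [sum_inner] at h
  simp only [inner_sum, D.inner_γ] at h
  rw [h]
  norm_cast

theorem norm_sum_left_le {ι : Type*} (p : A) (s : Finset ι) (q : ι → A) (x : ι → K) :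
    ‖∑ i ∈ s, D.γ (p * q i) (x i)‖ ≤ ‖p‖ * ‖∑ i ∈ s, D.γ (q i) (x i)‖ := by
  obtain ⟨r, hr⟩ := exists_star_mul_self_add_eq p
  have h : ‖∑ i ∈ s, D.γ (r * q i) (x i)‖ ^ 2 + ‖∑ i ∈ s, D.γ (p * q i) (x i)‖ ^ 2
      = ‖p‖ ^ 2 * ‖∑ i ∈ s, D.γ (q i) (x i)‖ ^ 2 := by
    apply Complex.ofReal_injective
    rw [Complex.ofReal_add, Complex.ofReal_mul, norm_sq_sum, norm_sq_sum, norm_sq_sum,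
      ← Finset.sum_add_distrib, Finset.mul_sum]
    refine Finset.sum_congr rfl fun i _ => ?_
    rw [← Finset.sum_add_distrib, Finset.mul_sum]
    refine Finset.sum_congr rfl fun j _ => ?_
    rw [← inner_add_right, ← inner_smul_right]
    congr 1
    have h1 : star (r * q i) * (r * q j) + star (p * q i) * (p * q j)
        = ((‖p‖ ^ 2 : ℝ) : ℂ) • (star (q i) * q j) := by
      have h2 : star (r * q i) * (r * q j) + star (p * q i) * (p * q j)
          = star (q i) * (star r * r + star p * p) * q j := by
        rw [star_mul, star_mul]; noncomm_ring
      rw [h2, hr, mul_smul_comm, mul_one, smul_mul_assoc]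
    have h3 := congrArg φ h1
    rw [map_add, map_smul] at h3
    exact congrArg (fun T : B => (T : K →L[ℂ] K) (x j)) h3
  rw [← mul_pow] at h
  exact (sq_le_sq₀ (norm_nonneg _) (by positivity)).1
    (by linarith [sq_nonneg ‖∑ i ∈ s, D.γ (r * q i) (x i)‖])

theorem norm_sum_right_le {ι : Type*} (b : B.commutant) (s : Finset ι) (q : ι → A) (x : ι → K) :
    ‖∑ i ∈ s, D.γ (q i) ((b : K →L[ℂ] K) (x i))‖ ≤ ‖b‖ * ‖∑ i ∈ s, D.γ (q i) (x i)‖ := by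
  obtain ⟨r, hr⟩ := exists_star_mul_self_add_eq b
  have h : ‖∑ i ∈ s, D.γ (q i) ((r : K →L[ℂ] K) (x i))‖ ^ 2
      + ‖∑ i ∈ s, D.γ (q i) ((b : K →L[ℂ] K) (x i))‖ ^ 2
      = ‖b‖ ^ 2 * ‖∑ i ∈ s, D.γ (q i) (x i)‖ ^ 2 := by
    apply Complex.ofReal_injective
    rw [Complex.ofReal_add, Complex.ofReal_mul, norm_sq_sum, norm_sq_sum, norm_sq_sum,
      ← Finset.sum_add_distrib, Finset.mul_sum]
    refine Finset.sum_congr rfl fun i _ => ?_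
    rw [← Finset.sum_add_distrib, Finset.mul_sum]
    refine Finset.sum_congr rfl fun j _ => ?_
    rw [inner_commutant_commutant, inner_commutant_commutant, ← inner_add_right,
      ← inner_smul_right]
    exact congrArg (fun T : B.commutant => inner ℂ (x i) ((T : K →L[ℂ] K)
      ((φ (star (q i) * q j) : K →L[ℂ] K) (x j)))) hr
  rw [← mul_pow] at h
  exact (sq_le_sq₀ (norm_nonneg _) (by positivity)).1
    (by linarith [sq_nonneg ‖∑ i ∈ s, D.γ (q i) ((r : K →L[ℂ] K) (x i))‖])

theorem γ_smul (p : A) (c : ℂ) (x : K) : D.γ (c • p) x = c • D.γ p x := by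
  refine D.ext_inner fun q y => ?_
  rw [inner_smul_left, D.inner_γ, D.inner_γ, star_smul, smul_mul_assoc, map_smul]
  exact inner_smul_right _ _ _

theorem γ_add (p q : A) (x : K) : D.γ (p + q) x = D.γ p x + D.γ q x := by
  refine D.ext_inner fun r y => ?_
  rw [inner_add_left, D.inner_γ, D.inner_γ, D.inner_γ, star_add, add_mul, map_add]
  exact inner_add_right _ _ _

variable [CompleteSpace L]

theorem exists_left (p : A) : ∃ T : L →L[ℂ] L, ∀ q x, T (D.γ q x) = D.γ (p * q) x := by
  obtain ⟨T, hT⟩ := exists_continuousLinearMap_of_norm_le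
    (fun i : A × K => D.γ (p * i.1) i.2) D.dense ‖p‖ fun s c => by
      simpa using D.norm_sum_left_le p s (fun i => i.1) fun i => c i • i.2
  exact ⟨T, fun q x => hT (q, x)⟩

theorem exists_right (b : B.commutant) :
    ∃ T : L →L[ℂ] L, ∀ q x, T (D.γ q x) = D.γ q ((b : K →L[ℂ] K) x) := by
  obtain ⟨T, hT⟩ := exists_continuousLinearMap_of_norm_le
    (fun i : A × K => D.γ i.1 ((b : K →L[ℂ] K) i.2)) D.dense ‖b‖ fun s c => by
      simpa using D.norm_sum_right_le b s (fun i => i.1) fun i => c i • i.2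
  exact ⟨T, fun q x => hT (q, x)⟩

/-- The action of `A` on the dilation space by left multiplication. -/
noncomputable def left (p : A) : L →L[ℂ] L := (D.exists_left p).choose

theorem left_γ (p q : A) (x : K) : D.left p (D.γ q x) = D.γ (p * q) x :=
  (D.exists_left p).choose_spec q x

/-- The action of the commutant of `B` on the dilation space. -/
noncomputable def right (b : B.commutant) : L →L[ℂ] L := (D.exists_right b).choose

theorem right_γ (b : B.commutant) (q : A) (x : K) :
    D.right b (D.γ q x) = D.γ q ((b : K →L[ℂ] K) x) :=
  (D.exists_right b).choose_spec q x

theorem left_star (p : A) : D.left (star p) = adjoint (D.left p) := by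
  refine D.ext_clm fun q x => D.ext_inner fun r y => ?_
  rw [adjoint_inner_left, left_γ, left_γ, D.inner_γ, D.inner_γ, star_mul, star_star, mul_assoc]

theorem right_star (b : B.commutant) : D.right (star b) = adjoint (D.right b) := by
  refine D.ext_clm fun q x => D.ext_inner fun r y => ?_
  rw [adjoint_inner_left, right_γ, right_γ, D.inner_γ, D.inner_γ]
  have h2 := mem_commutant_iff.1 b.2 _ (φ (star q * r)).2
  change inner ℂ (adjoint (b : K →L[ℂ] K) x) _ = _
  rw [adjoint_inner_left]
  exact congrArg (fun T : K →L[ℂ] K => inner ℂ x (T y)) h2.symm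

theorem left_mul (p q : A) : D.left (p * q) = D.left p * D.left q :=
  D.ext_clm fun r x => by
    rw [mul_apply_eq_comp, left_γ, left_γ, left_γ, mul_assoc]

theorem left_add (p q : A) : D.left (p + q) = D.left p + D.left q :=
  D.ext_clm fun r x => by
    rw [add_apply, left_γ, left_γ, left_γ, add_mul, γ_add]

theorem left_smul (c : ℂ) (p : A) : D.left (c • p) = c • D.left p :=
  D.ext_clm fun r x => by
    rw [smul_apply, left_γ, left_γ, smul_mul_assoc, γ_smul]

theorem left_one : D.left 1 = 1 :=
  D.ext_clm fun r x => by
    rw [left_γ, one_mul]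
    rfl

theorem right_mul_left (b : B.commutant) (p : A) :
    D.right b * D.left p = D.left p * D.right b :=
  D.ext_clm fun r x => by
    rw [mul_apply_eq_comp, mul_apply_eq_comp, left_γ, right_γ, right_γ, left_γ]

theorem adjoint_left_comp (p : A) :
    adjoint (D.γ 1) ∘L D.left p ∘L D.γ 1 = (φ p : K →L[ℂ] K) := by
  ext x
  refine ext_inner_left ℂ fun y => ?_
  rw [comp_apply, comp_apply, adjoint_inner_right, left_γ, D.inner_γ]
  simp

/-- The operators in the commutant of `A` that act on the image of `K` through the commutant
of `B`. -/
def intertwiners : Set (L →L[ℂ] L) :=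
  {S | (∀ p, S * D.left p = D.left p * S) ∧
    ∃ b ∈ B.commutant, S ∘L D.γ 1 = D.γ 1 ∘L b ∧ adjoint S ∘L D.γ 1 = D.γ 1 ∘L adjoint b}

theorem right_mem_intertwiners (b : B.commutant) : D.right b ∈ D.intertwiners := by
  refine ⟨D.right_mul_left b, b, b.2, ?_, ?_⟩
  · ext x
    exact D.right_γ b 1 x
  · ext x
    rw [← right_star]
    exact D.right_γ (star b) 1 x

/-- The von Neumann algebra on the dilation space through which `φ` factors: the commutant of the
action of the commutant of `B`. -/
noncomputable def algebra : VonNeumannAlgebra L where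
  toStarSubalgebra := StarSubalgebra.centralizer ℂ D.intertwiners
  -- A commutant equals its own double commutant.
  centralizer_centralizer' := by simp

theorem mem_algebra_iff {T : L →L[ℂ] L} :
    T ∈ D.algebra ↔ ∀ S ∈ D.intertwiners, S * T = T * S ∧ star S * T = T * star S :=
  StarSubalgebra.mem_centralizer_iff ℂ

theorem left_mem_algebra (p : A) : D.left p ∈ D.algebra := by
  refine D.mem_algebra_iff.2 fun S hS => ⟨hS.1 p, ?_⟩
  have h := congrArg star (hS.1 (star p))
  rw [star_mul, star_mul, left_star, ← star_eq_adjoint, star_star] at h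
  exact h.symm

/-- Intertwiners and their adjoints preserve the range of `γ 1`. Having this projection inside the
algebra is what allows cutting down by it in `isCPExtreme_compress`. -/
theorem rangeProjection_mem_algebra : rangeProjection (D.γ 1) ∈ D.algebra := by
  refine D.mem_algebra_iff.2 fun S hS => ?_
  obtain ⟨-, b, -, h1, h2⟩ := hS
  exact ⟨rangeProjection_commute _ h1 h2,
    rangeProjection_commute _ h2 (by rwa [star_eq_adjoint, adjoint_adjoint])⟩

/-- `T` commutes with `right b`, which acts on the image of `γ 1` as `b`; hence the compression
commutes with the whole commutant of `B`. -/
theorem compress_mem {T : L →L[ℂ] L} (hT : T ∈ D.algebra) :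
    adjoint (D.γ 1) ∘L T ∘L D.γ 1 ∈ B := by
  suffices h : adjoint (D.γ 1) ∘L T ∘L D.γ 1 ∈ B.commutant.commutant by
    rwa [B.commutant_commutant] at h
  rw [mem_commutant_iff]
  intro b hb
  have h1 := (D.mem_algebra_iff.1 hT _ (D.right_mem_intertwiners ⟨b, hb⟩)).1
  have h2 : ∀ x, D.right ⟨b, hb⟩ (D.γ 1 x) = D.γ 1 (b x) := D.right_γ ⟨b, hb⟩ 1
  have h3 : ∀ x, adjoint (D.right ⟨b, hb⟩) (D.γ 1 x) = D.γ 1 (adjoint b x) := fun x => by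
    rw [← right_star]
    exact D.right_γ (star ⟨b, hb⟩) 1 x
  ext x
  refine ext_inner_left ℂ fun y => ?_
  rw [mul_apply_eq_comp, mul_apply_eq_comp, ← adjoint_inner_left b, comp_apply, comp_apply,
    comp_apply, comp_apply, adjoint_inner_right, adjoint_inner_right, ← h2, ← h3,
    adjoint_inner_left]
  exact congrArg (fun S : L →L[ℂ] L => inner ℂ (D.γ 1 y) (S (D.γ 1 x))) h1

/-- The representation of `A` in the algebra of the dilation. -/
noncomputable def rep : A →⋆ₐ[ℂ] D.algebra where
  toFun p := ⟨D.left p, D.left_mem_algebra p⟩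
  map_one' := Subtype.ext D.left_one
  map_mul' p q := Subtype.ext (D.left_mul p q)
  map_zero' := Subtype.ext (by simpa using D.left_smul 0 0)
  map_add' p q := Subtype.ext (D.left_add p q)
  commutes' c := Subtype.ext (by
    change D.left (algebraMap ℂ A c) = algebraMap ℂ (L →L[ℂ] L) c
    rw [Algebra.algebraMap_eq_smul_one, Algebra.algebraMap_eq_smul_one, left_smul, left_one])
  map_star' p := Subtype.ext (D.left_star p)

/-- The compression of the algebra of the dilation to `B`. -/
noncomputable def compress : D.algebra →ₗ[ℂ] B where
  toFun T := ⟨adjoint (D.γ 1) ∘L (T : L →L[ℂ] L) ∘L D.γ 1, D.compress_mem T.2⟩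
  map_add' S T := Subtype.ext (by
    change adjoint (D.γ 1) ∘L ((S : L →L[ℂ] L) + (T : L →L[ℂ] L)) ∘L D.γ 1
      = adjoint (D.γ 1) ∘L (S : L →L[ℂ] L) ∘L D.γ 1 + adjoint (D.γ 1) ∘L (T : L →L[ℂ] L) ∘L D.γ 1
    rw [add_comp, comp_add])
  map_smul' c T := Subtype.ext (by
    change adjoint (D.γ 1) ∘L (c • (T : L →L[ℂ] L)) ∘L D.γ 1
      = c • (adjoint (D.γ 1) ∘L (T : L →L[ℂ] L) ∘L D.γ 1)
    rw [smul_comp, comp_smul])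

theorem inner_compress (T : D.algebra) (x y : K) :
    inner ℂ x ((D.compress T : K →L[ℂ] K) y)
      = inner ℂ (D.γ 1 x) ((T : L →L[ℂ] L) (D.γ 1 y)) := by
  change inner ℂ x (adjoint (D.γ 1) ((T : L →L[ℂ] L) (D.γ 1 y))) = _
  rw [adjoint_inner_right]

theorem compress_comp_rep : D.compress ∘ₗ linearMapOfHom D.rep = φ := by
  ext1 p
  exact Subtype.ext (D.adjoint_left_comp p)

theorem isKernelPositive_compress : IsKernelPositive D.compress := by
  intro n q x
  have h : ∀ i j, inner ℂ (x i) ((D.compress (star (q i) * q j) : K →L[ℂ] K) (x j))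
      = inner ℂ ((q i : L →L[ℂ] L) (D.γ 1 (x i))) ((q j : L →L[ℂ] L) (D.γ 1 (x j))) := by
    intro i j
    rw [inner_compress]
    change inner ℂ _ (adjoint (q i : L →L[ℂ] L) ((q j : L →L[ℂ] L) (D.γ 1 (x j)))) = _
    rw [adjoint_inner_right]
  have h2 : ∑ i, ∑ j, inner ℂ (x i) ((D.compress (star (q i) * q j) : K →L[ℂ] K) (x j))
      = inner ℂ (∑ i, (q i : L →L[ℂ] L) (D.γ 1 (x i)))
        (∑ j, (q j : L →L[ℂ] L) (D.γ 1 (x j))) := by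
    rw [sum_inner]
    simp only [h, inner_sum]
  rw [h2, inner_self_eq_norm_sq_to_K]
  positivity

theorem isNCP_compress : IsNCP D.compress where
  completelyPositive := D.isKernelPositive_compress.completelyPositive
  normal := by
    refine scottContinuous_of_exists_inner_sub_lt D.isKernelPositive_compress.monotone ?_
    intro S hne hdir a ha x ε hε
    obtain ⟨d, hd, h⟩ := exists_inner_sub_lt hne hdir ha (D.γ 1 x) hε
    refine ⟨d, hd, ?_⟩
    rwa [← map_sub, inner_compress]

/-- Both summands vanish on `1 - e`, with `e` the range projection of `γ 1`, so only elements `e a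
e` matter; these map into the closure of the range of `γ 1`, as the variational argument requires.
-/
theorem isCPExtreme_compress : IsCPExtreme D.compress := by
  intro φ₁ φ₂ hφ₁ hφ₂ h₁ h₂ s t hs ht hst hφ
  set r := rangeProjection (D.γ 1) with hr
  have hrp : IsStarProjection r := isStarProjection_rangeProjection _
  let e : D.algebra := ⟨r, D.rangeProjection_mem_algebra⟩
  have he : IsStarProjection e :=
    ⟨Subtype.ext hrp.isIdempotentElem.eq, Subtype.ext hrp.isSelfAdjoint.star_eq⟩
  have h0 : D.compress (1 - e) = 0 := by
    apply Subtype.ext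
    change adjoint (D.γ 1) ∘L (1 - r) ∘L D.γ 1 = 0
    rw [sub_comp, hr, rangeProjection_comp]
    change adjoint (D.γ 1) ∘L (D.γ 1 - D.γ 1) = 0
    rw [sub_self, comp_zero]
  have h0' : (s : ℂ) • φ₁ (1 - e) + (t : ℂ) • φ₂ (1 - e) = 0 := by
    rw [← h0, ← hφ]; rfl
  have hpn : 0 ≤ 1 - e := he.one_sub.nonneg
  have hz₁ : φ₁ (1 - e) = 0 :=
    eq_zero_of_smul_add_smul_eq_zero hs ht (hφ₁.map_nonneg hpn) (hφ₂.map_nonneg hpn) h0'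
  have hz₂ : φ₂ (1 - e) = 0 :=
    eq_zero_of_smul_add_smul_eq_zero ht hs (hφ₂.map_nonneg hpn) (hφ₁.map_nonneg hpn)
      ((add_comm _ _).trans h0')
  ext1 a
  rw [← hφ₁.map_compress he hz₁, ← hφ₂.map_compress he hz₂]
  have hea : e * (e * a * e) = e * a * e := by
    rw [← mul_assoc, ← mul_assoc, he.isIdempotentElem.eq]
  generalize e * a * e = b at hea
  refine eq_of_convex_combination hφ₁ hφ₂ hs ht hst hφ h₁ h₂ (D.γ 1) (b : L →L[ℂ] L) ?_ ?_ ?_ ?_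
  · rfl
  · rfl
  · rfl
  · intro x
    have h3 : r * (b : L →L[ℂ] L) = b := congrArg Subtype.val hea
    rw [← h3]
    exact rangeProjection_apply_mem _ _

end KernelDilation

end Dilation

/-! ### Normality of the representation on the dilation space. -/

section Normality

theorem re_inner_add_le {L : Type*} [NormedAddCommGroup L] [InnerProductSpace ℂ L]
    {T : L →L[ℂ] L} (hT : 0 ≤ T) (m n : L) :
    (inner ℂ (m + n) (T (m + n))).re
      ≤ 2 * (inner ℂ m (T m)).re + 2 * (inner ℂ n (T n)).re := by
  have h := (Complex.le_def.1 (nonneg_iff_inner.1 hT (m - n))).1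
  simp only [map_sub, map_add, inner_sub_left, inner_sub_right, inner_add_left, inner_add_right,
    Complex.sub_re, Complex.add_re, Complex.zero_re] at h ⊢
  linarith

theorem re_inner_smul {L : Type*} [NormedAddCommGroup L] [InnerProductSpace ℂ L]
    (T : L →L[ℂ] L) (c : ℂ) (m : L) :
    (inner ℂ (c • m) (T (c • m))).re = ‖c‖ ^ 2 * (inner ℂ m (T m)).re := by
  rw [map_smul, inner_smul_left, inner_smul_right, ← mul_assoc, Complex.conj_mul',
    ← Complex.ofReal_pow, Complex.re_ofReal_mul]

variable {H K L : Type u} [NormedAddCommGroup H] [InnerProductSpace ℂ H] [CompleteSpace H]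
  [NormedAddCommGroup K] [InnerProductSpace ℂ K] [CompleteSpace K]
  [NormedAddCommGroup L] [InnerProductSpace ℂ L] [CompleteSpace L]
  {A : VonNeumannAlgebra H} {B : VonNeumannAlgebra K} {φ : A →ₗ[ℂ] B} (D : KernelDilation φ L)

theorem KernelDilation.rep_monotone : Monotone D.rep :=
  (isKernelPositive_of_completelyPositive
    (CompletelyPositiveMapClass.toCompletelyPositiveLinearMap D.rep)).monotone

theorem KernelDilation.left_nonneg {a : A} (ha : 0 ≤ a) : 0 ≤ D.left a := by
  have h := D.rep_monotone ha
  rw [map_zero] at h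
  exact h

theorem KernelDilation.left_sub (a b : A) : D.left (a - b) = D.left a - D.left b := by
  rw [eq_sub_iff_add_eq, ← left_add, sub_add_cancel]

/-- At `γ p x` the vector state of `rep` is `⟪x, φ (p⋆ · p) x⟫`, normal because `φ` and conjugation
are. `re_inner_add_le` carries this to the span, and density with a uniform norm bound to all
vectors. -/
theorem KernelDilation.isNMIU_rep (hφ : IsNCP φ) : IsNMIU D.rep := by
  refine scottContinuous_of_exists_inner_sub_lt D.rep_monotone ?_
  intro S hne hdir a ha
  have hpos : ∀ d ∈ S, 0 ≤ D.left (a - d) := fun d hd => D.left_nonneg (sub_nonneg.2 (ha.1 hd))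
  have hanti : ∀ d e : A, d ≤ e → ∀ m, (inner ℂ m (D.left (a - e) m)).re
      ≤ (inner ℂ m (D.left (a - d) m)).re := by
    intro d e hde m
    have h := D.left_nonneg (sub_nonneg.2 hde)
    have h1 : a - d = (a - e) + (e - d) := by abel
    rw [h1, D.left_add, add_apply, inner_add_right, Complex.add_re]
    exact le_add_of_nonneg_right (Complex.le_def.1 (nonneg_iff_inner.1 h m)).1
  have hadd : ∀ m n : L, (∀ ε > 0, ∃ d ∈ S, (inner ℂ m (D.left (a - d) m)).re < ε) →
      (∀ ε > 0, ∃ d ∈ S, (inner ℂ n (D.left (a - d) n)).re < ε) →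
      ∀ ε > 0, ∃ d ∈ S, (inner ℂ (m + n) (D.left (a - d) (m + n))).re < ε := by
    intro m n hm hn ε hε
    obtain ⟨d₁, hd₁, h₁⟩ := hm (ε / 4) (by positivity)
    obtain ⟨d₂, hd₂, h₂⟩ := hn (ε / 4) (by positivity)
    obtain ⟨d, hd, hle₁, hle₂⟩ := hdir d₁ hd₁ d₂ hd₂
    refine ⟨d, hd, (re_inner_add_le (hpos d hd) m n).trans_lt ?_⟩
    linarith [hanti d₁ d hle₁ m, hanti d₂ d hle₂ n]
  have hγ : ∀ (p : A) (x : K), ∀ ε > 0,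
      ∃ d ∈ S, (inner ℂ (D.γ p x) (D.left (a - d) (D.γ p x))).re < ε := by
    intro p x ε hε
    obtain ⟨d, hd, h⟩ := exists_inner_sub_lt_of_scottContinuous
      ((scottContinuous_conjugate p).comp hφ.normal) hne hdir ha x hε
    refine ⟨d, hd, ?_⟩
    rw [D.left_γ, D.inner_γ]
    have h1 : star p * ((a - d) * p) = star p * a * p - star p * d * p := by noncomm_ring
    rw [h1, map_sub]
    exact h
  have hspan : ∀ m ∈ Submodule.span ℂ (Set.range fun i : A × K => D.γ i.1 i.2), ∀ ε > 0,
      ∃ d ∈ S, (inner ℂ m (D.left (a - d) m)).re < ε := by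
    intro m hm
    induction hm using Submodule.span_induction with
    | mem m hm =>
      obtain ⟨⟨p, x⟩, rfl⟩ := hm
      exact hγ p x
    | zero =>
      intro ε hε
      obtain ⟨d, hd⟩ := hne
      exact ⟨d, hd, by simpa using hε⟩
    | add m n _ _ hm hn => exact hadd m n hm hn
    | smul c m _ hm =>
      intro ε hε
      obtain ⟨d, hd, h⟩ := hm (ε / (‖c‖ ^ 2 + 1)) (by positivity)
      refine ⟨d, hd, ?_⟩
      rw [re_inner_smul]
      have h0 := (Complex.le_def.1 (nonneg_iff_inner.1 (hpos d hd) m)).1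
      rw [Complex.zero_re] at h0
      rw [lt_div_iff₀ (by positivity)] at h
      linarith
  have hall : ∀ m : L, ∀ ε > 0, ∃ d ∈ S, (inner ℂ m (D.left (a - d) m)).re < ε := by
    intro m ε hε
    obtain ⟨d₀, hd₀⟩ := hne
    set C := ‖D.left (a - d₀)‖
    have hδ : 0 < Real.sqrt (ε / (4 * (C + 1))) := Real.sqrt_pos.2 (by positivity)
    -- Above `d₀` the form at `m - n` is at most `C ‖m - n‖² < ε / 4`; the two terms, each doubled,
    -- then sum to less than `ε`.
    obtain ⟨n, hn, hmn⟩ := Metric.mem_closure_iff.1 (D.dense m) _ hδ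
    obtain ⟨d₁, hd₁, h₁⟩ := hspan n hn (ε / 4) (by positivity)
    obtain ⟨d, hd, hle₀, hle₁⟩ := hdir d₀ hd₀ d₁ hd₁
    refine ⟨d, hd, ?_⟩
    have h2 := re_inner_add_le (hpos d hd) n (m - n)
    rw [add_sub_cancel] at h2
    have h3 : (inner ℂ (m - n) (D.left (a - d₀) (m - n))).re ≤ C * ‖m - n‖ ^ 2 := by
      refine (Complex.re_le_norm _).trans ((norm_inner_le_norm _ _).trans ?_)
      calc ‖m - n‖ * ‖D.left (a - d₀) (m - n)‖ ≤ ‖m - n‖ * (C * ‖m - n‖) := by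
            gcongr; exact (D.left (a - d₀)).le_opNorm _
        _ = _ := by ring
    rw [dist_eq_norm] at hmn
    have h4 : ‖m - n‖ ^ 2 < ε / (4 * (C + 1)) := by
      calc _ < _ := pow_lt_pow_left₀ hmn (norm_nonneg _) two_ne_zero
        _ = _ := Real.sq_sqrt (by positivity)
    rw [lt_div_iff₀ (by positivity)] at h4
    have h5 := hanti d₀ d hle₀ (m - n)
    have h6 := hanti d₁ d hle₁ n
    nlinarith [sq_nonneg ‖m - n‖]
  intro m ε hε
  obtain ⟨d, hd, h⟩ := hall m ε hε
  refine ⟨d, hd, ?_⟩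
  rw [D.left_sub] at h
  exact h

end Normality

/-! ### Extremality of the second leg of a Paschke dilation. -/

section Paschke

variable {H K L : Type u} [NormedAddCommGroup H] [InnerProductSpace ℂ H] [CompleteSpace H]
  [NormedAddCommGroup K] [InnerProductSpace ℂ K] [CompleteSpace K]
  [NormedAddCommGroup L] [InnerProductSpace ℂ L] [CompleteSpace L]
  {A : VonNeumannAlgebra H} {B : VonNeumannAlgebra K} {P : VonNeumannAlgebra L}

/-- Kernels do not compose directly, since `φ (a⋆ b)` need not be of the form `c⋆ d`; positivity of
matrices does. -/
theorem IsKernelPositive.comp {φ : A →ₗ[ℂ] P} {ψ : P →ₗ[ℂ] B} (hψ : IsKernelPositive ψ)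
    (hφ : IsKernelPositive φ) : IsKernelPositive (ψ ∘ₗ φ) := by
  obtain ⟨f, rfl⟩ := hφ.completelyPositive
  obtain ⟨g, rfl⟩ := hψ.completelyPositive
  exact isKernelPositive_of_completelyPositive ⟨g.toLinearMap ∘ₗ f.toLinearMap, fun k M hM =>
    g.map_cstarMatrix_nonneg' k _ (f.map_cstarMatrix_nonneg' k M hM)⟩

theorem IsNCP.comp {φ : A →ₗ[ℂ] P} {ψ : P →ₗ[ℂ] B} (hψ : IsNCP ψ) (hφ : IsNCP φ) :
    IsNCP (ψ ∘ₗ φ) where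
  completelyPositive := (hψ.isKernelPositive.comp hφ.isKernelPositive).completelyPositive
  normal := hφ.normal.comp hψ.normal

theorem isNCP_id : IsNCP (LinearMap.id : A →ₗ[ℂ] A) :=
  isNCP_linearMapOfHom (ϱ := StarAlgHom.id ℂ A) ScottContinuous.id

theorem IsPaschkeDilation.isCPExtreme {φ : A →ₗ[ℂ] B} {ϱ : A →⋆ₐ[ℂ] P} {f : P →ₗ[ℂ] B}
    (h : IsPaschkeDilation φ ϱ f) : IsCPExtreme f := by
  obtain ⟨M, _, _, _, ⟨D⟩⟩ := h.ncp.isKernelPositive.exists_kernelDilation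
  have hπ : IsNMIU D.rep := D.isNMIU_rep h.ncp
  have hcomp : D.compress ∘ₗ linearMapOfHom (D.rep.comp ϱ) = φ := by
    rw [← h.comp_eq]
    conv_rhs => rw [← D.compress_comp_rep]
    rfl
  obtain ⟨σ, ⟨hσ, hσϱ, hfσ⟩, -⟩ := h.existsUnique M D.algebra (D.rep.comp ϱ) D.compress
    (ScottContinuous.comp (f := ϱ) (g := D.rep) h.nmiu hπ) D.isNCP_compress hcomp
  -- Both sides mediate from the Paschke dilation to itself, so uniqueness identifies them.
  have hid : σ ∘ₗ linearMapOfHom D.rep = LinearMap.id := by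
    refine (h.existsUnique L P ϱ f h.nmiu h.ncp h.comp_eq).unique
      ⟨hσ.comp (isNCP_linearMapOfHom hπ), hσϱ, ?_⟩ ⟨isNCP_id, rfl, rfl⟩
    rw [← LinearMap.comp_assoc, hfσ, D.compress_comp_rep]
  have hσ1 : σ 1 = 1 := by
    have h1 := congrArg (fun g : P →ₗ[ℂ] P => g 1) hid
    change σ (D.rep 1) = 1 at h1
    rwa [map_one] at h1
  intro f₁ f₂ hf₁ hf₂ h₁ h₂ s t hs ht hst hf
  -- Equality after `σ` suffices, because `rep` is a right inverse of `σ`.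
  have h12 : f₁ ∘ₗ σ = f₂ ∘ₗ σ := by
    refine D.isCPExtreme_compress _ _ (hf₁.comp hσ.isKernelPositive)
      (hf₂.comp hσ.isKernelPositive) ?_ ?_ s t hs ht hst ?_
    · rw [← hfσ, LinearMap.comp_apply, LinearMap.comp_apply, hσ1, h₁]
    · rw [← hfσ, LinearMap.comp_apply, LinearMap.comp_apply, hσ1, h₂]
    · rw [← hfσ]
      exact congrArg (· ∘ₗ σ) hf
  have h3 := congrArg (· ∘ₗ linearMapOfHom D.rep) h12
  simp only [LinearMap.comp_assoc, hid, LinearMap.comp_id] at h3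
  exact h3

end Paschke

end VonNeumannAlgebra

theorem mainTheorem3 {H K : Type u}
    [NormedAddCommGroup H] [InnerProductSpace ℂ H] [CompleteSpace H]
    [NormedAddCommGroup K] [InnerProductSpace ℂ K] [CompleteSpace K]
    (A : VonNeumannAlgebra H) (B : VonNeumannAlgebra K) :
    (∀ ϱ : A →⋆ₐ[ℂ] B, VonNeumannAlgebra.IsNMIU ϱ →
      VonNeumannAlgebra.IsNCPExtreme (VonNeumannAlgebra.linearMapOfHom ϱ)) ∧
    (∀ φ : A →ₗ[ℂ] B, VonNeumannAlgebra.IsNCP φ → VonNeumannAlgebra.IsPure φ →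
      VonNeumannAlgebra.IsNCPExtreme φ) ∧
    (∀ φ : A →ₗ[ℂ] B, VonNeumannAlgebra.IsNCP φ →
      ∀ (L : Type u) [NormedAddCommGroup L] [InnerProductSpace ℂ L] [CompleteSpace L]
        (P : VonNeumannAlgebra L) (ϱ : A →⋆ₐ[ℂ] P) (f : P →ₗ[ℂ] B),
        VonNeumannAlgebra.IsPaschkeDilation φ ϱ f →
          VonNeumannAlgebra.IsNCPExtreme (VonNeumannAlgebra.linearMapOfHom ϱ) ∧
          VonNeumannAlgebra.IsNCPExtreme f) := by
  refine ⟨fun ϱ hϱ => ?_, fun φ hφ hp => hp.isCPExtreme.isNCPExtreme hφ,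
    fun φ _ L _ _ _ P ϱ f h => ⟨?_, h.isCPExtreme.isNCPExtreme h.ncp⟩⟩
  · exact (VonNeumannAlgebra.isCPExtreme_linearMapOfHom ϱ).isNCPExtreme
      (VonNeumannAlgebra.isNCP_linearMapOfHom hϱ)
  · exact (VonNeumannAlgebra.isCPExtreme_linearMapOfHom ϱ).isNCPExtreme
      (VonNeumannAlgebra.isNCP_linearMapOfHom h.nmiu)
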